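/- Let $n\ge 2$ and $q\in(1,\infty)$, and let $U\subset\mathbb R^n$ be a Lipschitz domain or a John domain. Then there is a constant $S=S(q,U)>0$ such that every $\psi\in L^1(U)$ with $\psi_U^{\#}\in L^q(U)$ satisfies $\psi_U^{\star}\in L^q(U)$ and $$\frac1{|U|}\int_U |\psi_U^{\star}|^q\,d\mathbf x\ \le\ S\left(\frac1{|U|}\int_U |\psi_U^{\#}|^q\,d\mathbf x+\left|\frac1{|U|}\int_U\psi\,d\mathbf x\right|^q\right).$$ Here $|V|$ denotes Lebesgue measure, $\langle f\rangle_V:=\frac1{|V|}\int_V f\,d\mathbf x$, and, for $\mathbf x\in U$, $$\psi_U^{\star}(\mathbf x)=\sup_{Q\ni\mathbf x,\ Q\subset U}\frac1{|Q|}\int_Q|\psi(\mathbf y)|\,d\mathbf y,\qquad \psi_U^{\#}(\mathbf x)=\sup_{Q\ni\mathbf x,\ Q\subset U}\frac1{|Q|}\int_Q|\psi(\mathbf y)-\langle\psi\rangle_Q|\,d\mathbf y$$ are the (local) Hardy–Littlewood and Fefferman–Stein maximal functions, where $Q$ ranges over the nonempty, bounded, open cubes with faces parallel to the coordinate hyperplanes.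 A bounded domain is a bounded, nonempty, connected, open set. A Lipschitz domain is a bounded domain $U$ such that every boundary point has a neighbourhood in which, in suitable Cartesian coordinates $(y',y_n)\in\mathbb R^{n-1}\times\mathbb R$, $U$ coincides with $\{y_n>g(y')\}$ for some Lipschitz function $g:\mathbb R^{n-1}\to\mathbb R$. A John domain is a bounded domain $U$ for which there are a point $\mathbf x_0\in U$ and constants $c>0$, $L$ such that every $\mathbf x\in U$ can be joined to $\mathbf x_0$ by a rectifiable curve $\gamma:[0,s]\to U$, parametrized by arc length, with $s\le L$, $\gamma(0)=\mathbf x$, $\gamma(s)=\mathbf x_0$ and $\operatorname{dist}(\gamma(t),\partial U)\ge c\,t$ for all $t\in[0,s]$. -/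

import Mathlib

open MeasureTheory Set
open scoped ENNReal NNReal

noncomputable section

/-- The open `n`-dimensional cube with faces parallel to the coordinate hyperplanes, lower corner
`a` and side length `l`. -/
def openCube {n : ℕ} (a : EuclideanSpace ℝ (Fin n)) (l : ℝ) : Set (EuclideanSpace ℝ (Fin n)) :=
  {y | ∀ i, y i ∈ Ioo (a i) (a i + l)}

/-- The Hardy-Littlewood maximal function of `ψ` relative to `V`: the supremum of the averages of
`|ψ|` over all cubes `Q ⊆ V` that contain `x`. It takes values in `[0, ∞]`. -/
def hlMaximal {n : ℕ} (V : Set (EuclideanSpace ℝ (Fin n))) (ψ : EuclideanSpace ℝ (Fin n) → ℝ)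
    (x : EuclideanSpace ℝ (Fin n)) : ℝ≥0∞ :=
  ⨆ (a : EuclideanSpace ℝ (Fin n)) (l : ℝ) (_ : 0 < l) (_ : x ∈ openCube a l)
    (_ : openCube a l ⊆ V), ⨍⁻ y in openCube a l, ‖ψ y‖ₑ ∂volume

/-- The Fefferman-Stein (sharp) maximal function of `ψ` relative to `V`: the supremum of the mean
oscillations of `ψ` over all cubes `Q ⊆ V` that contain `x`. It takes values in `[0, ∞]`. -/
def sharpMaximal {n : ℕ} (V : Set (EuclideanSpace ℝ (Fin n))) (ψ : EuclideanSpace ℝ (Fin n) → ℝ)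
    (x : EuclideanSpace ℝ (Fin n)) : ℝ≥0∞ :=
  ⨆ (a : EuclideanSpace ℝ (Fin n)) (l : ℝ) (_ : 0 < l) (_ : x ∈ openCube a l)
    (_ : openCube a l ⊆ V), ⨍⁻ y in openCube a l, ‖ψ y - ⨍ z in openCube a l, ψ z‖ₑ ∂volume

/-- A bounded domain: a bounded, nonempty, connected, open set. -/
structure IsBoundedDomain {n : ℕ} (U : Set (EuclideanSpace ℝ (Fin n))) : Prop where
  isOpen : IsOpen U
  isConnected : IsConnected U
  isBounded : Bornology.IsBounded U

/-- A (strongly) Lipschitz domain: a bounded domain such that, near every boundary point and in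
suitable Cartesian coordinates `(y', yₙ)` (given by the linear isometry `T`), the domain is the
set of points that lie strictly above the graph of a Lipschitz function of `y'`. -/
structure IsLipschitzDomain {n : ℕ} (U : Set (EuclideanSpace ℝ (Fin n))) : Prop
    extends IsBoundedDomain U where
  locally_epigraph : ∀ x ∈ frontier U,
    ∃ (r : ℝ) (T : EuclideanSpace ℝ (Fin n) ≃ₗᵢ[ℝ] WithLp 2 (EuclideanSpace ℝ (Fin (n - 1)) × ℝ))
      (g : EuclideanSpace ℝ (Fin (n - 1)) → ℝ) (K : ℝ≥0),
      0 < r ∧ LipschitzWith K g ∧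
        ∀ y ∈ Metric.ball x r, (y ∈ U ↔ g (T y).fst < (T y).snd)

/-- A John domain: a bounded domain with a center `x₀` that can be joined to every point `x` of the
domain by a rectifiable curve `γ` in the domain, parametrized by arc length and starting at `x`,
of uniformly bounded length, such that the distance of `γ t` to the boundary is at least a fixed
positive multiple of `t`. -/
structure IsJohnDomain {n : ℕ} (U : Set (EuclideanSpace ℝ (Fin n))) : Prop
    extends IsBoundedDomain U where
  exists_center : ∃ x₀ ∈ U, ∃ c L : ℝ, 0 < c ∧ ∀ x ∈ U,
    ∃ (s : ℝ) (γ : ℝ → EuclideanSpace ℝ (Fin n)), 0 ≤ s ∧ s ≤ L ∧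
      HasUnitSpeedOn γ (Icc 0 s) ∧ γ 0 = x ∧ γ s = x₀ ∧
      ∀ t ∈ Icc 0 s, γ t ∈ U ∧ c * t ≤ Metric.infDist (γ t) (frontier U)

end

/-! The maximal theorem over cubes (`exists_lintegral_maxFn_rpow_le`) bounds the `L^q` norm of `ψ*`
by that of `ψ` on `U`. So it suffices to bound `ψ` minus its average over one fixed reference cube
by `ψ#` in `L^q(U)`; Hölder's inequality then trades that average for the average over `U`.

The geometry enters through `TwistedConeCondition`, which John and Lipschitz domains share, together
with boundedness and connectedness. Along the cone from `x`, cubes of geometrically growing size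
link a cube near `x`, of size comparable to the distance from `x` to the complement, to the
reference cube. If `h` dominates the oscillations of `f`, averaging each oscillation bound over half
of its cube turns the sum over the chain into `coneOp U B h x` plus a multiple of `∫ h`
(`TwistedConeCondition.exists_avg_bound`). The adjoint of `coneOp` is pointwise dominated by the
maximal function (`lintegral_coneKernel_mul_le`).

Locally, a Calderón-Zygmund stopping argument is run at height `t` on the grid cubes whose doubles
lie in `U` (`OscBound.lintegral_superlevel_le`). A stopping cube either has an admissible parent
that was not selected, so its average is at most `t` plus a multiple of `h`, or it has Whitney size,
and the chain estimate `A` controls its average. Hence the mass of `|f|` above `2t` is at most a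
multiple of the integral of `h + A` over the set where `2^n M f > t`.

Integrating in `t` against `t^(q-2)` gives `∫ |f|^q ≤ C ∫ (h + A) (M f)^(q-1)`. Transposing the
chain operator, Hölder's inequality and the maximal theorem bound the right side by a multiple of
`‖h‖_q ‖f‖_q^(q-1)`. Cancelling the power of `‖f‖_q` needs it to be finite, so bounded `f` come
first (`TwistedConeCondition.exists_bounded_lintegral_le`); truncation and Fatou's lemma give the
general case. -/

/-! ### Cubes in Euclidean space -/

/-- The Euclidean space of dimension `n`. -/
abbrev Euc (n : ℕ) : Type := EuclideanSpace ℝ (Fin n)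

/-- The open cube with centre `z` and half side length `r`. -/
def cube {n : ℕ} (z : Euc n) (r : ℝ) : Set (Euc n) :=
  {y | ∀ i, |y i - z i| < r}

theorem cube_eq_openCube {n : ℕ} (z : Euc n) (r : ℝ) :
    cube z r = openCube (WithLp.toLp 2 fun i => z i - r) (2 * r) := by
  ext y
  simp only [cube, openCube, mem_ofPred_eq, mem_Ioo, abs_lt]
  refine forall_congr' fun i => ?_
  constructor <;> rintro ⟨h1, h2⟩ <;> constructor <;> linarith

theorem openCube_eq_cube {n : ℕ} (a : Euc n) (l : ℝ) :
    openCube a l = cube (WithLp.toLp 2 fun i => a i + l / 2) (l / 2) := by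
  ext y
  simp only [cube, openCube, mem_ofPred_eq, mem_Ioo, abs_lt]
  refine forall_congr' fun i => ?_
  constructor <;> rintro ⟨h1, h2⟩ <;> constructor <;> linarith

theorem isOpen_cube {n : ℕ} (z : Euc n) (r : ℝ) : IsOpen (cube z r) := by
  have : cube z r = ⋂ i, {y : Euc n | |y i - z i| < r} := by ext; simp [cube]
  rw [this]
  exact isOpen_iInter_of_finite fun i => isOpen_lt (by fun_prop) continuous_const

theorem measurableSet_cube {n : ℕ} (z : Euc n) (r : ℝ) : MeasurableSet (cube z r) :=
  (isOpen_cube z r).measurableSet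

theorem mem_cube_self {n : ℕ} (z : Euc n) {r : ℝ} (hr : 0 < r) : z ∈ cube z r := by
  intro i; simpa using hr

theorem cube_subset_cube {n : ℕ} {z w : Euc n} {r s : ℝ}
    (h : ∀ i, |z i - w i| + r ≤ s) : cube z r ⊆ cube w s := by
  intro y hy i
  have h1 := hy i
  have h2 := h i
  have h3 := abs_sub_le (y i) (z i) (w i)
  linarith

theorem cube_subset_cube_of_le {n : ℕ} {z : Euc n} {r s : ℝ} (h : r ≤ s) :
    cube z r ⊆ cube z s := fun _ hy i => (hy i).trans_le h

theorem abs_apply_sub_le_dist {n : ℕ} (x y : Euc n) (i : Fin n) : |x i - y i| ≤ dist x y := by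
  rw [dist_eq_norm]
  simpa using PiLp.norm_apply_le (x - y) i

theorem dist_le_of_forall_abs_le {n : ℕ} {x y : Euc n} {r : ℝ}
    (h : ∀ i, |x i - y i| ≤ r) : dist x y ≤ n * r := by
  rw [EuclideanSpace.dist_eq]
  rcases Nat.eq_zero_or_pos n with rfl | hn
  · simp
  have hr : 0 ≤ r := (abs_nonneg _).trans (h ⟨0, hn⟩)
  apply Real.sqrt_le_iff.2 ⟨by positivity, ?_⟩
  calc ∑ i, dist (x i) (y i) ^ 2 ≤ ∑ _i : Fin n, r ^ 2 := by
        refine Finset.sum_le_sum fun i _ => ?_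
        rw [Real.dist_eq]
        exact pow_le_pow_left₀ (abs_nonneg _) (h i) 2
    _ = n * r ^ 2 := by simp
    _ ≤ (n * r) ^ 2 := by
        rw [mul_pow]
        have : (1 : ℝ) ≤ n := by exact_mod_cast hn
        gcongr
        nlinarith

theorem ball_subset_cube {n : ℕ} (z : Euc n) (r : ℝ) : Metric.ball z r ⊆ cube z r :=
  fun y hy i => (abs_apply_sub_le_dist y z i).trans_lt hy

theorem cube_div_subset_ball {n : ℕ} (hn : 0 < n) (z : Euc n) (r : ℝ) :
    cube z (r / n) ⊆ Metric.ball z r := by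
  intro y hy
  have hn' : (0 : ℝ) < n := by exact_mod_cast hn
  have : Nonempty (Fin n) := ⟨⟨0, hn⟩⟩
  obtain ⟨i0, hi0⟩ := Finite.exists_max (fun i : Fin n => |y i - z i|)
  have h1 := dist_le_of_forall_abs_le hi0
  have h2 := hy i0
  rw [lt_div_iff₀ hn'] at h2
  rw [Metric.mem_ball]
  linarith

theorem volume_openCube {n : ℕ} (a : Euc n) (l : ℝ) :
    volume (openCube a l) = ENNReal.ofReal l ^ n := by
  have h : openCube a l = (WithLp.ofLp : Euc n → Fin n → ℝ) ⁻¹'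
      (Set.univ.pi fun i => Ioo (a i) (a i + l)) := by
    ext y; simp [openCube]
  rw [h, (PiLp.volume_preserving_ofLp (Fin n)).measure_preimage
    (MeasurableSet.univ_pi fun i => measurableSet_Ioo).nullMeasurableSet, Real.volume_pi_Ioo]
  simp

theorem volume_cube {n : ℕ} (z : Euc n) (r : ℝ) :
    volume (cube z r) = ENNReal.ofReal (2 * r) ^ n := by
  rw [cube_eq_openCube, volume_openCube]

theorem volume_cube_ne_top {n : ℕ} (z : Euc n) (r : ℝ) : volume (cube z r) ≠ ∞ := by
  rw [volume_cube]; finiteness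

theorem volume_cube_ne_zero {n : ℕ} (z : Euc n) {r : ℝ} (hr : 0 < r) : volume (cube z r) ≠ 0 := by
  rw [volume_cube]
  exact pow_ne_zero _ (by simpa using hr)

theorem volume_cube_mul {n : ℕ} (z w : Euc n) {c : ℝ} (hc : 0 ≤ c) (r : ℝ) :
    volume (cube z (c * r)) = ENNReal.ofReal c ^ n * volume (cube w r) := by
  rw [volume_cube, volume_cube, ← mul_pow, ← ENNReal.ofReal_mul hc]
  congr 2; ring

/-! ### Averages -/

/-- Move `c` inside the average and enlarge the domain of integration. This drives the comparisons
of averages over nested sets below. -/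
theorem enorm_setAverage_sub_le {α : Type*} [MeasurableSpace α] {μ : Measure α} {A B : Set α}
    (hAB : A ⊆ B) (hA : μ A ≠ 0) (hB : μ B ≠ ∞) {f : α → ℝ} (hf : IntegrableOn f B μ) (c : ℝ) :
    ‖(⨍ y in A, f y ∂μ) - c‖ₑ ≤ (∫⁻ y in B, ‖f y - c‖ₑ ∂μ) / μ A := by
  have hA' : μ A ≠ ∞ := ne_top_of_le_ne_top hB (measure_mono hAB)
  have hfA : IntegrableOn f A μ := hf.mono_set hAB
  have h1 : (⨍ y in A, f y ∂μ) - c = ⨍ y in A, (f y - c) ∂μ := by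
    have hc : (⨍ _ in A, c ∂μ) = c := setAverage_const hA hA' c
    conv_lhs => rw [← hc]
    rw [setAverage_eq, setAverage_eq, setAverage_eq, integral_sub hfA (integrableOn_const hA'),
      smul_sub]
  rw [h1, average]
  refine (enorm_integral_le_lintegral_enorm _).trans ?_
  rw [lintegral_smul_measure, Measure.restrict_apply_univ, smul_eq_mul, mul_comm,
    ← div_eq_mul_inv]
  gcongr

/-- The mean oscillation of `f` over every cube contained in `U` is bounded by `h` at each point
of the cube. -/
def OscBound {n : ℕ} (U : Set (Euc n)) (f : Euc n → ℝ) (h : Euc n → ℝ≥0∞) : Prop :=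
  ∀ z r, cube z r ⊆ U → ∀ x ∈ cube z r,
    ∫⁻ y in cube z r, ‖f y - ⨍ w in cube z r, f w‖ₑ ≤ h x * volume (cube z r)

/-- The point `x` is free in the cube and need not lie in `A`; this freedom is what later allows `h
x` to be replaced by a mean of `h`. -/
theorem OscBound.enorm_sub_le {n : ℕ} {U : Set (Euc n)} {f : Euc n → ℝ} {h : Euc n → ℝ≥0∞}
    (hfh : OscBound U f h) (hf : IntegrableOn f U) {z : Euc n} {r : ℝ} (hz : cube z r ⊆ U)
    {A : Set (Euc n)} (hA : A ⊆ cube z r) (hA0 : volume A ≠ 0) {x : Euc n} (hx : x ∈ cube z r) :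
    ‖(⨍ y in A, f y) - ⨍ y in cube z r, f y‖ₑ ≤ volume (cube z r) / volume A * h x := by
  refine (enorm_setAverage_sub_le hA hA0 (volume_cube_ne_top z r) (hf.mono_set hz) _).trans ?_
  rw [mul_comm, ← mul_div_assoc]
  gcongr
  exact hfh z r hz x hx

/-! ### The uncentred maximal function -/

/-- The uncentred Hardy-Littlewood maximal function over cubes. -/
noncomputable def maxFn {n : ℕ} (g : Euc n → ℝ≥0∞) (x : Euc n) : ℝ≥0∞ :=
  ⨆ (z : Euc n) (r : ℝ) (_ : x ∈ cube z r), ⨍⁻ y in cube z r, g y ∂volume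

theorem le_maxFn {n : ℕ} (g : Euc n → ℝ≥0∞) {x z : Euc n} {r : ℝ} (hx : x ∈ cube z r) :
    (⨍⁻ y in cube z r, g y ∂volume) ≤ maxFn g x :=
  le_iSup₂_of_le z r (le_iSup_of_le hx le_rfl)

theorem lintegral_le_maxFn_mul {n : ℕ} (g : Euc n → ℝ≥0∞) {x z : Euc n} {r : ℝ}
    (hx : x ∈ cube z r) : ∫⁻ y in cube z r, g y ≤ maxFn g x * volume (cube z r) := by
  have h := le_maxFn g hx
  rw [setLAverage_eq] at h
  exact (ENNReal.div_le_iff ((isOpen_cube z r).measure_pos volume ⟨x, hx⟩).ne'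
    (volume_cube_ne_top z r)).1 h

/-- The supremum is uncountable, but each cube contributes a constant on an open set and zero
elsewhere, so the supremum is lower semicontinuous. -/
theorem measurable_maxFn {n : ℕ} (g : Euc n → ℝ≥0∞) : Measurable (maxFn g) := by
  refine LowerSemicontinuous.measurable ?_
  refine lowerSemicontinuous_iSup fun z => lowerSemicontinuous_iSup fun r => ?_
  intro x t ht
  by_cases hx : x ∈ cube z r
  · filter_upwards [(isOpen_cube z r).mem_nhds hx] with y hy
    simpa [hx, hy] using ht
  · simp [hx] at ht

theorem measurable_iSup_openCube {n : ℕ} (V : Set (Euc n)) (F : Euc n → ℝ → ℝ≥0∞) :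
    Measurable fun x => ⨆ (a : Euc n) (l : ℝ) (_ : 0 < l) (_ : x ∈ openCube a l)
      (_ : openCube a l ⊆ V), F a l := by
  refine LowerSemicontinuous.measurable ?_
  refine lowerSemicontinuous_iSup fun a => lowerSemicontinuous_iSup fun l =>
    lowerSemicontinuous_iSup fun hl => ?_
  intro x t ht
  by_cases hx : x ∈ openCube a l
  · have ho : IsOpen (openCube a l) := by rw [openCube_eq_cube]; exact isOpen_cube _ _
    filter_upwards [ho.mem_nhds hx] with y hy
    simpa [hx, hy] using ht
  · simp [hx] at ht

theorem measurable_hlMaximal {n : ℕ} (V : Set (Euc n)) (ψ : Euc n → ℝ) :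
    Measurable (hlMaximal V ψ) :=
  measurable_iSup_openCube V _

theorem measurable_sharpMaximal {n : ℕ} (V : Set (Euc n)) (ψ : Euc n → ℝ) :
    Measurable (sharpMaximal V ψ) :=
  measurable_iSup_openCube V _

theorem hlMaximal_le_maxFn {n : ℕ} {V : Set (Euc n)} (ψ : Euc n → ℝ) (x : Euc n) :
    hlMaximal V ψ x ≤ maxFn (V.indicator fun y => ‖ψ y‖ₑ) x := by
  refine iSup₂_le fun a l => iSup_le fun hl => iSup_le fun hx => iSup_le fun hV => ?_
  rw [openCube_eq_cube] at *
  refine le_trans (le_of_eq ?_) (le_maxFn _ hx)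
  rw [setLAverage_eq, setLAverage_eq]
  congr 1
  refine setLIntegral_congr_fun (measurableSet_cube _ _) fun y hy => ?_
  simp [hV hy]

theorem lintegral_le_sharpMaximal_mul {n : ℕ} {V : Set (Euc n)} (ψ : Euc n → ℝ) {x z : Euc n}
    {r : ℝ} (hr : 0 < r) (hV : cube z r ⊆ V) (hx : x ∈ cube z r) :
    ∫⁻ y in cube z r, ‖ψ y - ⨍ w in cube z r, ψ w‖ₑ ≤
      sharpMaximal V ψ x * volume (cube z r) := by
  rw [← ENNReal.div_le_iff (volume_cube_ne_zero z hr) (volume_cube_ne_top z r), ← setLAverage_eq]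
  rw [cube_eq_openCube] at *
  exact le_iSup₂_of_le _ (2 * r) (le_iSup_of_le (by linarith) (le_iSup_of_le hx
    (le_iSup_of_le hV le_rfl)))

/-! ### Layer cake formulas for functions with values in `[0, ∞]` -/

theorem setLIntegral_Ioo_ofReal_rpow {p : ℝ} (hp : 0 < p) {a : ℝ} (ha : 0 ≤ a) :
    ∫⁻ t in Ioo 0 a, ENNReal.ofReal (t ^ (p - 1)) = ENNReal.ofReal (a ^ p / p) := by
  have h1 := intervalIntegral.intervalIntegrable_rpow' (a := 0) (b := a) (r := p - 1) (by linarith)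
  rw [intervalIntegrable_iff_integrableOn_Ioo_of_le ha] at h1
  rw [← ofReal_integral_eq_lintegral_ofReal h1, ← integral_Ioc_eq_integral_Ioo,
    ← intervalIntegral.integral_of_le ha, integral_rpow (Or.inl (by linarith))]
  · simp [Real.zero_rpow hp.ne']
  · filter_upwards [ae_restrict_mem measurableSet_Ioo] with t ht
    exact Real.rpow_nonneg ht.1.le _

/-- The value `a = ∞` is included because maximal functions may take it; there the lower bounds
coming from all finite `b` force an infinite integral. -/
theorem lintegral_Ioi_rpow_indicator {p : ℝ} (hp : 0 < p) (a : ℝ≥0∞) :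
    ENNReal.ofReal p * ∫⁻ t in Ioi (0 : ℝ), ENNReal.ofReal (t ^ (p - 1)) *
      {t : ℝ | ENNReal.ofReal t < a}.indicator 1 t = a ^ p := by
  have key : ∀ b : ℝ, 0 ≤ b → ENNReal.ofReal p * ∫⁻ t in Ioo 0 b, ENNReal.ofReal (t ^ (p - 1)) =
      ENNReal.ofReal b ^ p := by
    intro b hb
    rw [setLIntegral_Ioo_ofReal_rpow hp hb, ← ENNReal.ofReal_mul hp.le,
      ENNReal.ofReal_rpow_of_nonneg hb hp.le]
    congr 1; field_simp
  have key2 : ∀ b : ℝ, 0 ≤ b → ENNReal.ofReal b ≤ a →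
      ENNReal.ofReal b ^ p ≤ ENNReal.ofReal p * ∫⁻ t in Ioi (0 : ℝ), ENNReal.ofReal (t ^ (p - 1)) *
      {t : ℝ | ENNReal.ofReal t < a}.indicator 1 t := by
    intro b hb hba
    rw [← key b hb]
    refine mul_le_mul_right ?_ _
    rw [← lintegral_indicator measurableSet_Ioo, ← lintegral_indicator measurableSet_Ioi]
    refine lintegral_mono fun t => ?_
    by_cases ht : t ∈ Ioo 0 b
    · have h1 : t ∈ Ioi (0 : ℝ) := ht.1
      have h2 : t ∈ {t : ℝ | ENNReal.ofReal t < a} :=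
        lt_of_lt_of_le ((ENNReal.ofReal_lt_ofReal_iff (ht.1.trans ht.2)).2 ht.2) hba
      simp [ht, h1, h2]
    · simp [ht]
  induction a with
  | top =>
    rw [ENNReal.top_rpow_of_pos hp, eq_top_iff]
    refine le_of_forall_lt fun c hc => ?_
    have h3 : c ^ (1 / p) ≠ ∞ := by
      simp [hc.ne, hp.le]
    have := key2 ((c ^ (1 / p)).toReal + 1) (by positivity) le_top
    refine lt_of_lt_of_le ?_ this
    rw [ENNReal.ofReal_add (by positivity) (by norm_num), ENNReal.ofReal_toReal h3]
    calc c = (c ^ (1 / p)) ^ p := by rw [← ENNReal.rpow_mul]; simp [hp.ne']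
      _ < _ := by
        refine ENNReal.rpow_lt_rpow ?_ hp
        exact ENNReal.lt_add_right h3 (by simp)
  | coe a =>
    refine le_antisymm ?_ ?_
    · rw [show (a : ℝ≥0∞) = ENNReal.ofReal a by simp, ← key a a.2]
      refine mul_le_mul_right ?_ _
      rw [← lintegral_indicator measurableSet_Ioo, ← lintegral_indicator measurableSet_Ioi]
      refine lintegral_mono fun t => ?_
      by_cases ht : t ∈ Ioi (0 : ℝ)
      · by_cases ht2 : ENNReal.ofReal t < ENNReal.ofReal a
        · have h3 : t ∈ Ioo (0 : ℝ) a :=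
            ⟨ht, by
              by_contra hcon
              exact absurd ht2 (not_lt.2 (ENNReal.ofReal_le_ofReal (not_lt.1 hcon)))⟩
          rw [indicator_of_mem ht, indicator_of_mem h3, indicator_of_mem (by exact ht2)]
          simp
        · rw [indicator_of_mem ht, indicator_of_notMem (by exact ht2)]
          simp
      · simp [ht]
    · have := key2 a a.2 (by simp)
      simpa using this

theorem lintegral_rpow_eq_layercake {α : Type*} [MeasurableSpace α] {μ : Measure α} [SFinite μ]
    {F : α → ℝ≥0∞} (hF : Measurable F) {p : ℝ} (hp : 0 < p) :
    ∫⁻ x, F x ^ p ∂μ = ENNReal.ofReal p * ∫⁻ t in Ioi (0 : ℝ),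
      ENNReal.ofReal (t ^ (p - 1)) * μ {x | ENNReal.ofReal t < F x} := by
  have hm : MeasurableSet {z : α × ℝ | ENNReal.ofReal z.2 < F z.1} :=
    measurableSet_lt (by fun_prop) (by fun_prop)
  have h1 : ∀ t : ℝ, ENNReal.ofReal (t ^ (p - 1)) * μ {x | ENNReal.ofReal t < F x} =
      ∫⁻ x, ENNReal.ofReal (t ^ (p - 1)) * {t : ℝ | ENNReal.ofReal t < F x}.indicator 1 t ∂μ := by
    intro t
    have hmt : MeasurableSet {x | ENNReal.ofReal t < F x} := measurableSet_lt measurable_const hF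
    rw [lintegral_const_mul _ (by
      have : Measurable ({x | ENNReal.ofReal t < F x}.indicator (1 : α → ℝ≥0∞)) :=
        measurable_one.indicator hmt
      exact this), ← lintegral_indicator_one hmt]
    rfl
  simp_rw [h1]
  rw [lintegral_lintegral_swap]
  · rw [← lintegral_const_mul']
    · refine lintegral_congr fun x => ?_
      exact (lintegral_Ioi_rpow_indicator hp (F x)).symm
    · simp
  · refine Measurable.aemeasurable ?_
    have : (Function.uncurry fun (t : ℝ) (x : α) => ENNReal.ofReal (t ^ (p - 1)) *
        {t : ℝ | ENNReal.ofReal t < F x}.indicator (1 : ℝ → ℝ≥0∞) t) =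
        fun z : ℝ × α => ENNReal.ofReal (z.1 ^ (p - 1)) *
        ({z : ℝ × α | ENNReal.ofReal z.1 < F z.2}.indicator (1 : ℝ × α → ℝ≥0∞) z) := rfl
    rw [this]
    refine Measurable.mul (by fun_prop) (measurable_one.indicator ?_)
    exact measurableSet_lt (by fun_prop) (by fun_prop)

theorem lintegral_mul_rpow_eq_layercake {α : Type*} [MeasurableSpace α] {μ : Measure α} [SFinite μ]
    {w F : α → ℝ≥0∞} (hw : Measurable w) (hF : Measurable F) {p : ℝ} (hp : 0 < p) :
    ∫⁻ x, w x * F x ^ p ∂μ = ENNReal.ofReal p * ∫⁻ t in Ioi (0 : ℝ),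
      ENNReal.ofReal (t ^ (p - 1)) * ∫⁻ x in {x | ENNReal.ofReal t < F x}, w x ∂μ := by
  have h := lintegral_rpow_eq_layercake (μ := μ.withDensity w) hF hp
  rw [lintegral_withDensity_eq_lintegral_mul _ hw (hF.pow_const p)] at h
  simp only [Pi.mul_apply] at h
  rw [h]
  congr 1
  refine lintegral_congr fun t => ?_
  rw [withDensity_apply _ (measurableSet_lt measurable_const hF)]

/-! ### The maximal theorem -/

theorem maxFn_congr_ae {n : ℕ} {g g' : Euc n → ℝ≥0∞} (h : g =ᵐ[volume] g') :
    maxFn g = maxFn g' := by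
  ext x
  simp only [maxFn]
  congr! 5
  exact laverage_congr (ae_restrict_of_ae h)

/-- Weak type (1,1) by Vitali covering: disjoint cubes with average at least `t` carry total measure
at most `∫ g / t`, and their enlargements cover the superlevel set. -/
theorem mul_volume_lt_maxFn_le {n : ℕ} (hn : 0 < n) (g : Euc n → ℝ≥0∞)
    {t : ℝ≥0∞} (ht0 : t ≠ 0) (ht : t ≠ ∞) :
    t * volume {x | t < maxFn g x} ≤ 5 ^ n * ∫⁻ x, g x := by
  by_cases hI : ∫⁻ x, g x = ∞
  · rw [hI, ENNReal.mul_top (by positivity)]; exact le_top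
  set I := ∫⁻ x, g x with hIdef
  let T : Set (Euc n × ℝ) := {b | 0 < b.2 ∧ t * volume (cube b.1 b.2) ≤ ∫⁻ y in cube b.1 b.2, g y}
  -- The summand `1` makes the side of a larger cube at least `1`, so that its `n`-th power
  -- dominates the side itself.
  have hbdd : ∀ b ∈ T, b.2 ≤ 1 + (I / t).toReal := by
    intro b hb
    by_contra! hcon
    have hIt : I / t ≠ ∞ := ENNReal.div_ne_top hI ht0
    have h1 : t * volume (cube b.1 b.2) ≤ I := hb.2.trans (setLIntegral_le_lintegral _ _)
    have h2 : volume (cube b.1 b.2) ≤ I / t := by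
      rw [ENNReal.le_div_iff_mul_le (Or.inl ht0) (Or.inl ht), mul_comm]; exact h1
    rw [volume_cube, ← ENNReal.ofReal_pow (by linarith [hb.1]),
      ENNReal.ofReal_le_iff_le_toReal hIt] at h2
    have h3 : (0 : ℝ) ≤ (I / t).toReal := ENNReal.toReal_nonneg
    have h4 : 2 * b.2 ≤ (2 * b.2) ^ n := le_self_pow₀ (by linarith) hn.ne'
    linarith
  -- A cube meeting a selected one, and at most twice as large, lies in its enlargement by `1 + 2 *
  -- 2 = 5`.
  obtain ⟨u, huT, hdisj, hcov⟩ := Vitali.exists_disjoint_subfamily_covering_enlargement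
    (fun b : Euc n × ℝ => cube b.1 b.2) T (fun b => b.2) 2 one_lt_two (fun b hb => hb.1.le)
    (1 + (I / t).toReal) hbdd (fun b hb => ⟨b.1, mem_cube_self _ hb.1⟩)
  have hucount : u.Countable := hdisj.countable_of_isOpen (fun b _ => isOpen_cube _ _)
    (fun b hb => ⟨b.1, mem_cube_self _ (huT hb).1⟩)
  have hsub : {x | t < maxFn g x} ⊆ ⋃ b ∈ u, cube b.1 (5 * b.2) := by
    intro x hx
    simp only [mem_ofPred_eq, maxFn, lt_iSup_iff] at hx
    obtain ⟨z, r, hxz, hlt⟩ := hx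
    have hr : 0 < r := (abs_nonneg _).trans_lt (hxz ⟨0, hn⟩)
    have hT : (z, r) ∈ T := by
      refine ⟨hr, ?_⟩
      rw [setLAverage_eq, ENNReal.lt_div_iff_mul_lt (Or.inl (volume_cube_ne_zero z hr))
        (Or.inl (volume_cube_ne_top z r))] at hlt
      exact hlt.le
    obtain ⟨b, hb, ⟨y, hy1, hy2⟩, hle⟩ := hcov _ hT
    refine mem_biUnion hb fun i => ?_
    have h1 := hxz i
    have h2 := hy1 i
    have h3 := hy2 i
    simp only [abs_lt] at h1 h2 h3 ⊢
    simp only at hle h2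
    constructor <;> linarith
  calc t * volume {x | t < maxFn g x} ≤ t * ∑' b : u, volume (cube b.1.1 (5 * b.1.2)) := by
        gcongr
        exact (measure_mono hsub).trans (measure_biUnion_le volume hucount _)
    _ = ∑' b : u, t * volume (cube b.1.1 (5 * b.1.2)) := ENNReal.tsum_mul_left.symm
    _ ≤ ∑' b : u, 5 ^ n * ∫⁻ y in cube b.1.1 b.1.2, g y := by
        refine ENNReal.tsum_le_tsum fun b => ?_
        rw [volume_cube_mul b.1.1 b.1.1 (by norm_num), mul_left_comm]
        simp only [ENNReal.ofReal_ofNat]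
        gcongr
        exact (huT b.2).2
    _ = 5 ^ n * ∑' b : u, ∫⁻ y in cube b.1.1 b.1.2, g y := ENNReal.tsum_mul_left
    _ = 5 ^ n * ∫⁻ y in ⋃ b ∈ u, cube b.1 b.2, g y := by
        rw [lintegral_biUnion hucount (fun b _ => measurableSet_cube _ _) hdisj]
    _ ≤ 5 ^ n * I := by gcongr; exact setLIntegral_le_lintegral _ _

theorem maxFn_le_add {n : ℕ} {g : Euc n → ℝ≥0∞} (hg : Measurable g) (t : ℝ≥0∞) (x : Euc n) :
    maxFn g x ≤ maxFn ({y | t < g y}.indicator g) x + t := by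
  refine iSup₂_le fun z r => iSup_le fun hx => ?_
  have hm : Measurable ({y | t < g y}.indicator g) :=
    hg.indicator (measurableSet_lt measurable_const hg)
  have hpos : volume (cube z r) ≠ 0 := ((isOpen_cube z r).measure_pos volume ⟨x, hx⟩).ne'
  rw [setLAverage_eq, ENNReal.div_le_iff hpos (volume_cube_ne_top z r), add_mul]
  calc ∫⁻ y in cube z r, g y ≤ ∫⁻ y in cube z r, ({y | t < g y}.indicator g y + t) := by
        refine lintegral_mono fun y => ?_
        by_cases hy : t < g y
        · rw [indicator_of_mem (by exact hy)]; exact le_self_add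
        · rw [indicator_of_notMem (by exact hy), zero_add]; exact not_lt.1 hy
    _ = (∫⁻ y in cube z r, {y | t < g y}.indicator g y) + t * volume (cube z r) := by
        rw [lintegral_add_left hm, setLIntegral_const]
    _ ≤ _ := by gcongr; exact lintegral_le_maxFn_mul _ hx

/-- Marcinkiewicz interpolation: at height `2t` only the part of `g` above `t` matters, and the weak
type bound applies to that part. -/
theorem exists_lintegral_maxFn_rpow_le {n : ℕ} (hn : 0 < n) {p : ℝ} (hp : 1 < p) :
    ∃ C : ℝ≥0∞, C ≠ ∞ ∧ ∀ g : Euc n → ℝ≥0∞, AEMeasurable g →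
      ∫⁻ x, maxFn g x ^ p ≤ C * ∫⁻ x, g x ^ p := by
  have hp0 : 0 < p := by linarith
  have hp1 : 0 < p - 1 := by linarith
  refine ⟨2 ^ p * (ENNReal.ofReal p * (5 ^ n * (ENNReal.ofReal (p - 1))⁻¹)), ?_, ?_⟩
  · have : (ENNReal.ofReal (p - 1))⁻¹ ≠ ∞ := by simpa using hp1
    have h2 : (2 : ℝ≥0∞) ^ p ≠ ∞ := by simp
    finiteness
  intro g hg
  wlog hgm : Measurable g generalizing g
  · rw [maxFn_congr_ae hg.ae_eq_mk]
    refine (this _ hg.measurable_mk.aemeasurable hg.measurable_mk).trans (le_of_eq ?_)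
    congr 1
    refine lintegral_congr_ae ?_
    filter_upwards [hg.ae_eq_mk] with x hx
    rw [hx]
  have hM := measurable_maxFn g
  -- Halving makes the layer at height `t` the set where the maximal function exceeds `2t`.
  have h1 : ∫⁻ x, maxFn g x ^ p = 2 ^ p * ∫⁻ x, (maxFn g x / 2) ^ p := by
    rw [← lintegral_const_mul _ (by fun_prop)]
    refine lintegral_congr fun x => ?_
    rw [← ENNReal.mul_rpow_of_nonneg _ _ hp0.le, ENNReal.mul_div_cancel (by simp) (by simp)]
  rw [h1, mul_assoc]
  gcongr
  rw [lintegral_rpow_eq_layercake (by fun_prop) hp0, mul_assoc]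
  gcongr
  have h2 : ∫⁻ x, g x ^ p = ∫⁻ x, g x * g x ^ (p - 1) := by
    refine lintegral_congr fun x => ?_
    conv_lhs => rw [show p = 1 + (p - 1) by ring]
    rw [ENNReal.rpow_add_of_nonneg _ _ zero_le_one hp1.le, ENNReal.rpow_one]
  rw [h2, lintegral_mul_rpow_eq_layercake hgm hgm hp1, mul_assoc]
  have h5 : (ENNReal.ofReal (p - 1))⁻¹ * (ENNReal.ofReal (p - 1) *
      ∫⁻ t in Ioi (0 : ℝ), ENNReal.ofReal (t ^ (p - 1 - 1)) *
        ∫⁻ x in {x | ENNReal.ofReal t < g x}, g x) = ∫⁻ t in Ioi (0 : ℝ),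
        ENNReal.ofReal (t ^ (p - 1 - 1)) * ∫⁻ x in {x | ENNReal.ofReal t < g x}, g x := by
    rw [← mul_assoc, ENNReal.inv_mul_cancel (by simpa using hp1) (by simp), one_mul]
  rw [h5, ← lintegral_const_mul' _ _ (by finiteness)]
  refine setLIntegral_mono' measurableSet_Ioi fun t ht => ?_
  have ht0 : 0 < t := ht
  have h6 : ENNReal.ofReal (t ^ (p - 1)) = ENNReal.ofReal (t ^ (p - 1 - 1)) * ENNReal.ofReal t := by
    rw [← ENNReal.ofReal_mul (by positivity), ← Real.rpow_add_one ht0.ne']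
    congr 2; ring
  rw [h6, mul_assoc, mul_left_comm (5 ^ n)]
  refine mul_le_mul_right ?_ _
  have hms : MeasurableSet {x | ENNReal.ofReal t < g x} := measurableSet_lt measurable_const hgm
  rw [← lintegral_indicator hms]
  refine le_trans ?_ (mul_volume_lt_maxFn_le hn _ (t := ENNReal.ofReal t) (by simpa using ht0)
    (by simp))
  refine mul_le_mul_right (measure_mono fun x hx => ?_) _
  have h7 := maxFn_le_add hgm (ENNReal.ofReal t) x
  rw [mem_ofPred_eq, ENNReal.lt_div_iff_mul_lt (by simp) (by simp), mul_two] at hx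
  exact lt_of_add_lt_add_right (hx.trans_le h7)

/-! ### Comparison of averages over different cubes -/

/-- Integrate the pointwise comparison over the free point `x ∈ D`. -/
theorem OscBound.enorm_sub_le_lintegral {n : ℕ} {U : Set (Euc n)} {f : Euc n → ℝ}
    {h : Euc n → ℝ≥0∞} (hfh : OscBound U f h) (hf : IntegrableOn f U) {z : Euc n} {r : ℝ}
    (hz : cube z r ⊆ U) {A : Set (Euc n)} (hA : A ⊆ cube z r) (hA0 : volume A ≠ 0)
    {D : Set (Euc n)} (hDm : MeasurableSet D) (hD : D ⊆ cube z r) (hD0 : volume D ≠ 0) :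
    ‖(⨍ y in A, f y) - ⨍ y in cube z r, f y‖ₑ ≤
      volume (cube z r) / volume A * ((∫⁻ y in D, h y) / volume D) := by
  have hDtop : volume D ≠ ∞ := ne_top_of_le_ne_top (volume_cube_ne_top z r) (measure_mono hD)
  have hK : volume (cube z r) / volume A ≠ ∞ := ENNReal.div_ne_top (volume_cube_ne_top z r) hA0
  rw [← mul_div_assoc, ENNReal.le_div_iff_mul_le (Or.inl hD0) (Or.inl hDtop),
    ← setLIntegral_const, ← lintegral_const_mul' _ _ hK]
  exact setLIntegral_mono' hDm fun x hx => hfh.enorm_sub_le hf hz hA hA0 (hD hx)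

/-- The averages over the two given cubes differ by at most a constant multiple of `∫ h` for all
functions with oscillation bounded by `h`. -/
def AvgComparable {n : ℕ} (U : Set (Euc n)) (z : Euc n) (r : ℝ) (w : Euc n) (s : ℝ) : Prop :=
  ∃ C : ℝ≥0∞, C ≠ ∞ ∧ ∀ (f : Euc n → ℝ) (h : Euc n → ℝ≥0∞), IntegrableOn f U → OscBound U f h →
    ‖(⨍ y in cube z r, f y) - ⨍ y in cube w s, f y‖ₑ ≤ C * ∫⁻ y in U, h y

theorem enorm_sub_le_of_cube_subset {n : ℕ} {U : Set (Euc n)} {f : Euc n → ℝ}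
    {h : Euc n → ℝ≥0∞} (hfh : OscBound U f h) (hf : IntegrableOn f U) {z w : Euc n} {r s : ℝ}
    (hs : 0 < s) (hzw : cube w s ⊆ cube z r) (hz : cube z r ⊆ U) :
    ‖(⨍ y in cube w s, f y) - ⨍ y in cube z r, f y‖ₑ ≤
      (volume (cube w s))⁻¹ * ∫⁻ y in U, h y := by
  have hr : volume (cube z r) ≠ 0 :=
    fun h0 => volume_cube_ne_zero w hs (measure_mono_null hzw h0)
  refine (hfh.enorm_sub_le_lintegral hf hz hzw (volume_cube_ne_zero w hs)
    (measurableSet_cube z r) subset_rfl hr).trans ?_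
  have : volume (cube z r) / volume (cube w s) *
      ((∫⁻ y in cube z r, h y) / volume (cube z r)) =
      (volume (cube w s))⁻¹ * ∫⁻ y in cube z r, h y := by
    rw [div_eq_mul_inv, div_eq_mul_inv, mul_mul_mul_comm, mul_comm (volume (cube z r)), mul_assoc,
      mul_left_comm (volume (cube z r)), ENNReal.mul_inv_cancel hr (volume_cube_ne_top z r), mul_one,
      mul_comm]
  rw [this]
  gcongr

theorem AvgComparable.of_subset {n : ℕ} {U : Set (Euc n)} {z w : Euc n} {r s : ℝ} (hs : 0 < s)
    (hzw : cube w s ⊆ cube z r) (hz : cube z r ⊆ U) : AvgComparable U w s z r :=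
  ⟨(volume (cube w s))⁻¹, by simpa using volume_cube_ne_zero w hs, fun _ _ hf hfh =>
    enorm_sub_le_of_cube_subset hfh hf hs hzw hz⟩

theorem AvgComparable.symm {n : ℕ} {U : Set (Euc n)} {z w : Euc n} {r s : ℝ}
    (H : AvgComparable U z r w s) : AvgComparable U w s z r := by
  obtain ⟨C, hC, H⟩ := H
  refine ⟨C, hC, fun f h hf hfh => ?_⟩
  rw [← enorm_neg, neg_sub]
  exact H f h hf hfh

theorem enorm_sub_le_add (a b c : ℝ) : ‖a - c‖ₑ ≤ ‖a - b‖ₑ + ‖b - c‖ₑ := by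
  rw [show a - c = (a - b) + (b - c) by ring]
  exact enorm_add_le _ _

theorem AvgComparable.trans {n : ℕ} {U : Set (Euc n)} {z w v : Euc n} {r s t : ℝ}
    (H : AvgComparable U z r w s) (H' : AvgComparable U w s v t) : AvgComparable U z r v t := by
  obtain ⟨C, hC, H⟩ := H
  obtain ⟨C', hC', H'⟩ := H'
  refine ⟨C + C', by finiteness, fun f h hf hfh => ?_⟩
  rw [add_mul]
  exact (enorm_sub_le_add _ _ _).trans (add_le_add (H f h hf hfh) (H' f h hf hfh))

theorem AvgComparable.of_same_center {n : ℕ} {U : Set (Euc n)} {z : Euc n} {r s : ℝ} (hr : 0 < r)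
    (hs : 0 < s) (hzr : cube z r ⊆ U) (hzs : cube z s ⊆ U) : AvgComparable U z r z s := by
  rcases le_total r s with h | h
  · exact .of_subset hr (cube_subset_cube_of_le h) hzs
  · exact (AvgComparable.of_subset hs (cube_subset_cube_of_le h) hzr).symm

theorem exists_cube_subset {n : ℕ} (hn : 0 < n) {U : Set (Euc n)} (hU : IsOpen U) {x : Euc n}
    (hx : x ∈ U) : ∃ r, 0 < r ∧ cube x r ⊆ U := by
  obtain ⟨ε, hε, hb⟩ := Metric.isOpen_iff.1 hU x hx
  have hn' : (0 : ℝ) < n := by exact_mod_cast hn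
  exact ⟨ε / n, by positivity, (cube_div_subset_ball hn x ε).trans hb⟩

/-- Comparability is symmetric and transitive and holds between nearby centres, so it spreads over a
connected set. Quantifying over all radii in `P` is what lets the relation compose. The constant
depends on the two cubes. -/
theorem avgComparable_of_mem {n : ℕ} (hn : 0 < n) {U : Set (Euc n)} (hU : IsOpen U)
    (hc : IsPreconnected U) {x y : Euc n} (hx : x ∈ U) (hy : y ∈ U) {r s : ℝ} (hr : 0 < r)
    (hs : 0 < s) (hxr : cube x r ⊆ U) (hys : cube y s ⊆ U) : AvgComparable U x r y s := by
  let P : Euc n → Euc n → Prop := fun x y => ∀ r s, 0 < r → 0 < s → cube x r ⊆ U →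
    cube y s ⊆ U → AvgComparable U x r y s
  suffices h : P x y from h r s hr hs hxr hys
  refine hc.induction₂ P ?_ ?_ ?_ hx hy
  · intro x hx
    obtain ⟨ρ, hρ, hρU⟩ := exists_cube_subset hn hU hx
    refine mem_nhdsWithin_of_mem_nhds ?_
    filter_upwards [(isOpen_cube x (ρ / 2)).mem_nhds (mem_cube_self x (half_pos hρ))] with y hy
    intro r s hr hs hxr hys
    have hsub : cube y (ρ / 2) ⊆ cube x ρ := cube_subset_cube fun i => by linarith [hy i]
    exact (AvgComparable.of_same_center hr hρ hxr hρU).trans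
      ((AvgComparable.of_subset (half_pos hρ) hsub hρU).symm.trans
      (AvgComparable.of_same_center (half_pos hρ) hs (hsub.trans hρU) hys))
  · intro x y z _ hy _ h1 h2 r s hr hs hxr hzs
    obtain ⟨ρ, hρ, hρU⟩ := exists_cube_subset hn hU hy
    exact (h1 r ρ hr hρ hxr hρU).trans (h2 ρ s hρ hs hρU hzs)
  · intro x y _ _ h r s hr hs hxr hys
    exact (h s r hs hr hys hxr).symm

/-- By total boundedness, every admissible cube of radius `η` contains one of finitely many cubes of
radius `η / 2`, so the non-uniform comparison becomes uniform. It serves the last cube of a chain,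
whose size is fixed but whose centre is not. -/
theorem exists_uniform_avg_bound {n : ℕ} (hn : 0 < n) {U : Set (Euc n)} (hU : IsOpen U)
    (hc : IsPreconnected U) (hb : Bornology.IsBounded U) {x₀ : Euc n} (hx₀ : x₀ ∈ U) {r₀ : ℝ}
    (hr₀ : 0 < r₀) (hx₀r : cube x₀ r₀ ⊆ U) {η : ℝ} (hη : 0 < η) :
    ∃ C : ℝ≥0∞, C ≠ ∞ ∧ ∀ z, cube z η ⊆ U → ∀ (f : Euc n → ℝ) (h : Euc n → ℝ≥0∞),
      IntegrableOn f U → OscBound U f h →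
      ‖(⨍ y in cube z η, f y) - ⨍ y in cube x₀ r₀, f y‖ₑ ≤ C * ∫⁻ y in U, h y := by
  let Z : Set (Euc n) := {z | cube z η ⊆ U}
  have hZU : Z ⊆ U := fun z hz => hz (mem_cube_self z hη)
  have htb : TotallyBounded Z := (hb.subset hZU).isCompact_closure.totallyBounded.subset subset_closure
  obtain ⟨t, htZ, htf, htc⟩ := Metric.finite_approx_of_totallyBounded htb _ (half_pos hη)
  have hcmp : ∀ w ∈ t, AvgComparable U w (η / 2) x₀ r₀ := fun w hw =>
    avgComparable_of_mem hn hU hc (hZU (htZ hw)) hx₀ (half_pos hη) hr₀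
      ((cube_subset_cube_of_le (by linarith)).trans (htZ hw)) hx₀r
  choose! C hC H using hcmp
  refine ⟨(volume (cube (0 : Euc n) (η / 2)))⁻¹ + ∑ w ∈ htf.toFinset, C w, ?_, ?_⟩
  · refine ENNReal.add_ne_top.2 ⟨by simpa using volume_cube_ne_zero 0 (half_pos hη), ?_⟩
    exact ENNReal.sum_ne_top.2 fun w hw => hC w (by simpa using hw)
  · intro z hz f h hf hfh
    obtain ⟨w, hw, hzw⟩ := mem_iUnion₂.1 (htc hz)
    have hsub : cube w (η / 2) ⊆ cube z η := cube_subset_cube fun i => by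
      have := abs_apply_sub_le_dist w z i
      rw [Metric.mem_ball, dist_comm] at hzw
      linarith
    refine (enorm_sub_le_add _ (⨍ y in cube w (η / 2), f y) _).trans ?_
    rw [add_mul]
    gcongr
    · rw [← enorm_neg, neg_sub]
      refine (enorm_sub_le_of_cube_subset hfh hf (half_pos hη) hsub hz).trans_eq ?_
      rw [volume_cube, volume_cube]
    · refine (H w hw f h hf hfh).trans ?_
      gcongr
      exact Finset.single_le_sum (f := C) (fun _ _ => zero_le) (by simpa using hw)

/-! ### Chains of cubes along curves with the twisted cone property -/

/-- There is a twisted cone in `U` with vertex `x`, aperture `c`, whose final ball has radius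
`r₀`: a `1`-Lipschitz curve `γ` starting at `x` such that `U` contains the ball of radius `c * t`
about each `γ t` and the ball of radius `r₀` about the end point. -/
def HasTwistedCone {n : ℕ} (U : Set (Euc n)) (c r₀ : ℝ) (x : Euc n) : Prop :=
  ∃ (s : ℝ) (γ : ℝ → Euc n), 0 ≤ s ∧ γ 0 = x ∧
    (∀ t ∈ Icc 0 s, ∀ t' ∈ Icc 0 s, dist (γ t) (γ t') ≤ |t - t'|) ∧
    (∀ t ∈ Icc 0 s, Metric.ball (γ t) (c * t) ⊆ U) ∧ Metric.ball (γ s) r₀ ⊆ U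

/-- Every point of `U` is the vertex of a twisted cone in `U`, with uniform constants. -/
def TwistedConeCondition {n : ℕ} (U : Set (Euc n)) : Prop :=
  ∃ c r₀ : ℝ, 0 < c ∧ 0 < r₀ ∧ ∀ x ∈ U, HasTwistedCone U c r₀ x

/-- The kernel `d(y)⁻ⁿ` restricted to `|x - y| ≤ B d(y)`, where `d` is the distance to the
complement of `U`. -/
noncomputable def coneKernel {n : ℕ} (U : Set (Euc n)) (B : ℝ) (x y : Euc n) : ℝ≥0∞ :=
  {y | dist x y ≤ B * Metric.infDist y Uᶜ}.indicator
    (fun y => (ENNReal.ofReal (Metric.infDist y Uᶜ) ^ n)⁻¹) y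

/-- The integral operator on `U` with kernel `coneKernel`. -/
noncomputable def coneOp {n : ℕ} (U : Set (Euc n)) (B : ℝ) (h : Euc n → ℝ≥0∞) (x : Euc n) :
    ℝ≥0∞ :=
  ∫⁻ y in U, h y * coneKernel U B x y

theorem le_infDist_of_ball_subset {n : ℕ} {U : Set (Euc n)} (hne : Uᶜ.Nonempty) {x : Euc n} {r : ℝ}
    (h : Metric.ball x r ⊆ U) : r ≤ Metric.infDist x Uᶜ := by
  rw [Metric.le_infDist hne]
  intro y hy
  by_contra! hcon
  exact hy (h (by rwa [Metric.mem_ball, dist_comm]))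

/-- A geometric sequence has boundedly many terms in a given interval. -/
theorem card_le_of_forall_mem_Icc {q lo hi : ℝ} {J : ℕ} (hq : 1 < q)
    (hJ : hi < q ^ J * lo) {l : ℝ} (hl : 0 < l) (S : Finset ℕ)
    (hS : ∀ k ∈ S, lo ≤ l * q ^ k ∧ l * q ^ k ≤ hi) : S.card ≤ J := by
  rcases S.eq_empty_or_nonempty with rfl | hne
  · simp
  have hsub : S ⊆ Finset.Ico (S.min' hne) (S.min' hne + J) := by
    intro k hk
    refine Finset.mem_Ico.2 ⟨S.min'_le k hk, ?_⟩
    by_contra! hcon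
    obtain ⟨j, rfl⟩ := Nat.exists_eq_add_of_le hcon
    have h1 := (hS _ (S.min'_mem hne)).1
    have h2 := (hS _ hk).2
    rw [pow_add, pow_add] at h2
    have h3 : (1 : ℝ) ≤ q ^ j := one_le_pow₀ hq.le
    have h4 : 0 < q ^ J := by positivity
    have h5 : 0 < l * q ^ S.min' hne := by positivity
    nlinarith [mul_le_mul_of_nonneg_left h1 h4.le, mul_pos h4 h5,
      mul_le_mul_of_nonneg_left h3 (mul_pos h4 h5).le]
  simpa using Finset.card_le_card hsub

/-- If `y` lies in the half cube of scale `ρ`, the full cube leaves room around `y`, so `d(y) ≥ a ρ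
/ 2`; the distance to `x` gives `d(y) ≤ (4n + 1) ρ`. Thus `ρ` is comparable to `d(y)`, which leaves
boundedly many indices, and `|x - y|` is at most a multiple of `d(y)`. -/
theorem sum_indicator_cube_le {n : ℕ} (hn : 0 < n) {U : Set (Euc n)} (hne : Uᶜ.Nonempty)
    {a : ℝ} (ha : 0 < a) (ha1 : a ≤ 1) :
    ∃ C : ℝ≥0∞, C ≠ ∞ ∧ ∀ (x : Euc n) (l : ℝ) (m : ℕ) (z : ℕ → Euc n), 0 < l →
      Metric.infDist x Uᶜ ≤ 3 * n * l →
      (∀ k ≤ m, dist (z k) x ≤ l * (1 + a / 4) ^ k) →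
      (∀ k ≤ m, cube (z k) (a * (l * (1 + a / 4) ^ k)) ⊆ U) → ∀ y : Euc n,
      ∑ k ∈ Finset.range (m + 1), (cube (z k) (a * (l * (1 + a / 4) ^ k) / 2)).indicator
        (fun _ => (volume (cube (z k) (a * (l * (1 + a / 4) ^ k) / 2)))⁻¹) y ≤
      C * coneKernel U (4 * n / a) x y := by
  have hn1 : (1 : ℝ) ≤ n := by exact_mod_cast hn
  -- The base is the ratio of consecutive scales, and the bound to beat is the ratio of the two
  -- endpoints for `ρ` in terms of `d(y)`.
  obtain ⟨J, hJ⟩ := pow_unbounded_of_one_lt (2 * (4 * n + 1) / a) (show 1 < 1 + a / 4 by linarith)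
  refine ⟨J * (ENNReal.ofReal (a / (4 * n + 1)) ^ n)⁻¹, ?_, ?_⟩
  · refine ENNReal.mul_ne_top (by simp) ?_
    rw [ENNReal.inv_ne_top]
    refine pow_ne_zero _ ?_
    simp only [ne_eq, ENNReal.ofReal_eq_zero, not_le]
    positivity
  intro x l m z hl hx hz hU y
  set ρ : ℕ → ℝ := fun k => l * (1 + a / 4) ^ k with hρ
  have hρl : ∀ k, l ≤ ρ k := fun k => by
    have : (1 : ℝ) ≤ (1 + a / 4) ^ k := one_le_pow₀ (by linarith)
    simp only [hρ]; nlinarith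
  set d := Metric.infDist y Uᶜ with hd
  have key : ∀ k ≤ m, y ∈ cube (z k) (a * ρ k / 2) →
      a * ρ k / 2 ≤ d ∧ d / (4 * n + 1) ≤ ρ k ∧ dist x y ≤ 4 * n / a * d := by
    intro k hk hy
    have h0 := hρl k
    have hρ0 : 0 < ρ k := by linarith
    have h1 : a * ρ k / 2 ≤ d := by
      refine le_infDist_of_ball_subset hne ((ball_subset_cube y _).trans
        ((cube_subset_cube fun i => ?_).trans (hU k hk)))
      have := hy i
      change _ ≤ a * ρ k
      linarith
    have h2 : dist y (z k) ≤ n * (a * ρ k / 2) := dist_le_of_forall_abs_le fun i => (hy i).le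
    have h2' : n * (a * ρ k / 2) ≤ n * ρ k := by gcongr; nlinarith
    have h3 : dist (z k) x ≤ ρ k := hz k hk
    have h4 : dist y x ≤ (n + 1) * ρ k := by linarith [dist_triangle y (z k) x]
    refine ⟨h1, ?_, ?_⟩
    · rw [div_le_iff₀ (by positivity)]
      have h5 : d ≤ Metric.infDist x Uᶜ + dist y x := Metric.infDist_le_infDist_add_dist
      nlinarith
    · rw [dist_comm, div_mul_eq_mul_div, le_div_iff₀ ha]
      have : (n + 1) * ρ k ≤ 2 * n * ρ k := by gcongr; linarith
      nlinarith
  classical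
  set S := (Finset.range (m + 1)).filter fun k => y ∈ cube (z k) (a * ρ k / 2) with hS
  have hSm : ∀ k ∈ S, k ≤ m ∧ y ∈ cube (z k) (a * ρ k / 2) := by
    intro k hk
    simp only [hS, Finset.mem_filter, Finset.mem_range] at hk
    exact ⟨by omega, hk.2⟩
  have hsum : ∑ k ∈ Finset.range (m + 1), (cube (z k) (a * ρ k / 2)).indicator
      (fun _ => (volume (cube (z k) (a * ρ k / 2)))⁻¹) y =
      ∑ k ∈ S, (volume (cube (z k) (a * ρ k / 2)))⁻¹ := by
    rw [hS, Finset.sum_filter]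
    refine Finset.sum_congr rfl fun k _ => ?_
    simp only [indicator]
  change ∑ k ∈ Finset.range (m + 1), (cube (z k) (a * ρ k / 2)).indicator
      (fun _ => (volume (cube (z k) (a * ρ k / 2)))⁻¹) y ≤ _
  rw [hsum]
  rcases S.eq_empty_or_nonempty with hSe | ⟨k₀, hk₀⟩
  · simp [hSe]
  obtain ⟨hk1, hk2⟩ := hSm k₀ hk₀
  obtain ⟨hd1, hd2, hd3⟩ := key k₀ hk1 hk2
  have hd0 : 0 < d := lt_of_lt_of_le (by have := hρl k₀; positivity) hd1
  have hker : coneKernel U (4 * n / a) x y = (ENNReal.ofReal d ^ n)⁻¹ := by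
    rw [coneKernel, indicator_of_mem (by exact hd3)]
  rw [hker]
  have hcard : S.card ≤ J := by
    refine card_le_of_forall_mem_Icc (q := 1 + a / 4) (lo := d / (4 * n + 1)) (hi := 2 * d / a)
      (by linarith) ?_ hl S fun k hk => ?_
    · calc 2 * d / a = (2 * (4 * n + 1) / a) * (d / (4 * n + 1)) := by field_simp
        _ < _ := by gcongr
    · obtain ⟨h1, h2, -⟩ := key k (hSm k hk).1 (hSm k hk).2
      refine ⟨h2, ?_⟩
      rw [le_div_iff₀ ha]
      change ρ k * a ≤ _
      linarith
  calc ∑ k ∈ S, (volume (cube (z k) (a * ρ k / 2)))⁻¹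
      ≤ ∑ k ∈ S, (ENNReal.ofReal (a / (4 * n + 1)) ^ n)⁻¹ * (ENNReal.ofReal d ^ n)⁻¹ := by
        refine Finset.sum_le_sum fun k hk => ?_
        obtain ⟨-, h2, -⟩ := key k (hSm k hk).1 (hSm k hk).2
        rw [← ENNReal.mul_inv (Or.inr (by finiteness)) (Or.inl (by finiteness)), ← mul_pow,
          ← ENNReal.ofReal_mul (by positivity), volume_cube]
        refine ENNReal.inv_le_inv.2 (pow_le_pow_left' (ENNReal.ofReal_le_ofReal ?_) n)
        calc a / (4 * n + 1) * d = a * (d / (4 * n + 1)) := by ring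
          _ ≤ a * ρ k := by gcongr
          _ = 2 * (a * ρ k / 2) := by ring
    _ = S.card * ((ENNReal.ofReal (a / (4 * n + 1)) ^ n)⁻¹ * (ENNReal.ofReal d ^ n)⁻¹) := by
        rw [Finset.sum_const, nsmul_eq_mul]
    _ ≤ J * ((ENNReal.ofReal (a / (4 * n + 1)) ^ n)⁻¹ * (ENNReal.ofReal d ^ n)⁻¹) := by
        gcongr
    _ = _ := by rw [mul_assoc]

theorem volume_cube_div_le {n : ℕ} (z w : Euc n) {r s c : ℝ} (hc : 0 ≤ c)
    (h : r ≤ c * s) : volume (cube z r) / volume (cube w s) ≤ ENNReal.ofReal c ^ n := by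
  refine ENNReal.div_le_of_le_mul ?_
  rw [← volume_cube_mul z w hc]
  exact measure_mono (cube_subset_cube_of_le h)

theorem enorm_sub_le_sum_range (f : ℕ → ℝ) (m : ℕ) :
    ‖f 0 - f m‖ₑ ≤ ∑ k ∈ Finset.range m, ‖f k - f (k + 1)‖ₑ := by
  induction m with
  | zero => simp
  | succ m ih =>
    rw [Finset.sum_range_succ]
    exact (enorm_sub_le_add _ (f m) _).trans (by gcongr)

-- The chain has scales `ρ k = l (1 + a/4)^k` and centres `γ (ρ k - l)`. Averages are taken over
-- cubes of radius `a ρ k / 4`, while oscillation is measured on the cubes of radius `a ρ k`, each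
-- containing the small cubes of index `k` and `k + 1`.
set_option maxHeartbeats 1000000 in
theorem TwistedConeCondition.exists_avg_bound {n : ℕ} (hn : 0 < n) {U : Set (Euc n)}
    (hU : IsOpen U) (hc : IsPreconnected U) (hb : Bornology.IsBounded U)
    (hcone : TwistedConeCondition U) {x₀ : Euc n} (hx₀ : x₀ ∈ U) {R₀ : ℝ}
    (hR₀ : 0 < R₀) (hx₀R : cube x₀ R₀ ⊆ U) :
    ∃ (a B : ℝ) (C : ℝ≥0∞), 0 < a ∧ a ≤ 1 / 2 ∧ 0 < B ∧ C ≠ ∞ ∧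
      ∀ (f : Euc n → ℝ) (h : Euc n → ℝ≥0∞),
      IntegrableOn f U → OscBound U f h → Measurable h → ∀ x ∈ U, ∀ l : ℝ, 0 < l →
      cube x (l / 2) ⊆ U → Metric.infDist x Uᶜ ≤ 3 * n * l →
      ‖(⨍ y in cube x (a * l), f y) - ⨍ y in cube x₀ R₀, f y‖ₑ ≤
        C * (coneOp U B h x + ∫⁻ y in U, h y) := by
  have hne : Uᶜ.Nonempty := by
    rw [nonempty_compl]
    rintro rfl
    have : Nonempty (Fin n) := ⟨⟨0, hn⟩⟩
    exact NormedSpace.unbounded_univ ℝ (Euc n) hb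
  have hn1 : (1 : ℝ) ≤ n := by exact_mod_cast hn
  obtain ⟨c, r₀, hc0, hr₀, H⟩ := hcone
  set κ := min 1 (c / n) with hκ
  have hκ0 : 0 < κ := lt_min one_pos (by positivity)
  have hκ1 : κ ≤ 1 := min_le_left _ _
  -- For `t ≥ l / 4` one has `l + t ≤ 5 t`, so radius `a (l + t) ≤ κ t` fits in the ball of the
  -- cone. For `t ≤ l / 4` the radius is at most `l / 4`, and the cube stays in `cube x (l / 2)`.
  set a := κ / 5 with ha
  have ha0 : 0 < a := by positivity
  have ha1 : a ≤ 1 := by linarith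
  -- Since `r₀ ≤ 6 n ρ m` will hold at the end of the chain, `η` is at most `a ρ m / 4`, yet
  -- independent of `x`.
  set η := a / 4 * r₀ / (6 * n) with hη
  have hη0 : 0 < η := by positivity
  obtain ⟨C₁, hC₁, H₁⟩ := sum_indicator_cube_le hn hne ha0 ha1
  obtain ⟨C₂, hC₂, H₂⟩ := exists_uniform_avg_bound hn hU hc hb hx₀ hR₀ hx₀R hη0
  set K : ℝ≥0∞ := 2 * 4 ^ n + volume U / volume (cube (0 : Euc n) η) with hK
  have hKtop : K ≠ ∞ := by
    have := hb.measure_lt_top (μ := volume)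
    have h3 : volume U / volume (cube (0 : Euc n) η) ≠ ∞ :=
      ENNReal.div_ne_top this.ne (volume_cube_ne_zero 0 hη0)
    finiteness
  refine ⟨a / 4, 4 * n / a, K * C₁ + C₂, by positivity, by linarith, by positivity,
    by finiteness, ?_⟩
  intro f h hf hfh hhm x hx l hl hxl hxd
  obtain ⟨s, γ, hs, hγ0, hγ, hγU, hγs⟩ := H x hx
  -- cubes of radius comparable to `l + t` about `γ t` are contained in `U`
  have hball : ∀ t ∈ Icc 0 s, cube (γ t) (a * (l + t)) ⊆ U := by
    intro t ht
    rcases le_total t (l / 4) with h1 | h1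
    · refine (cube_subset_cube fun i => ?_).trans hxl
      have h2 := hγ t ht 0 ⟨le_rfl, hs⟩
      rw [hγ0, sub_zero, abs_of_nonneg ht.1] at h2
      have h3 := abs_apply_sub_le_dist (γ t) x i
      nlinarith
    · refine (cube_subset_cube_of_le ?_).trans ((cube_div_subset_ball hn _ _).trans (hγU t ht))
      have h2 : κ * t ≤ c / n * t := by gcongr; exacts [ht.1, min_le_right _ _]
      have h3 : c * t / n = c / n * t := by ring
      rw [h3]
      refine le_trans ?_ h2
      rw [ha]
      nlinarith
  -- The index `m` is the last with `ρ m ≤ l + s`: the parameters stay in `[0, s]`, and less than `a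
  -- ρ m / 4` of the parameter interval remains.
  obtain ⟨m, hm1, hm2⟩ := exists_nat_pow_near (x := (l + s) / l) (y := 1 + a / 4)
    (by rw [le_div_iff₀ hl]; linarith) (by linarith)
  rw [le_div_iff₀ hl, mul_comm] at hm1
  rw [div_lt_iff₀ hl, mul_comm, pow_succ, ← mul_assoc] at hm2
  set ρ : ℕ → ℝ := fun k => l * (1 + a / 4) ^ k with hρ
  have hρ0 : ρ 0 = l := by simp [hρ]
  have hρmono : Monotone ρ := fun i j hij => by
    simp only [hρ]; gcongr; linarith
  have hρl : ∀ k, l ≤ ρ k := fun k => hρ0 ▸ hρmono (Nat.zero_le k)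
  have hρpos : ∀ k, 0 < ρ k := fun k => hl.trans_le (hρl k)
  have hρsucc : ∀ k, ρ (k + 1) = ρ k * (1 + a / 4) := fun k => by simp only [hρ]; ring
  have hρm : ρ m ≤ l + s := hm1
  have hρm' : l + s < ρ m * (1 + a / 4) := hm2
  have htk : ∀ k ≤ m, ρ k - l ∈ Icc 0 s := fun k hk =>
    ⟨by linarith [hρl k], by linarith [hρmono hk]⟩
  set z : ℕ → Euc n := fun k => γ (ρ k - l) with hz
  have hz0 : z 0 = x := by simp [hz, hρ0, hγ0]
  have hzU : ∀ k ≤ m, cube (z k) (a * ρ k) ⊆ U := fun k hk => by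
    have := hball _ (htk k hk)
    rwa [add_sub_cancel] at this
  have hzx : ∀ k ≤ m, dist (z k) x ≤ ρ k := fun k hk => by
    have := hγ _ (htk k hk) 0 ⟨le_rfl, hs⟩
    rw [hγ0, sub_zero, abs_of_nonneg (htk k hk).1] at this
    exact this.trans (by linarith)
  -- the mean of `h` over the half cubes
  set D : ℕ → Set (Euc n) := fun k => cube (z k) (a * ρ k / 2) with hD
  have hD0 : ∀ k, volume (D k) ≠ 0 := fun k =>
    volume_cube_ne_zero _ (by have := hρpos k; positivity)
  have hDsub : ∀ k, D k ⊆ cube (z k) (a * ρ k) := fun k =>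
    cube_subset_cube_of_le (by have := mul_pos ha0 (hρpos k); linarith)
  set I : ℕ → ℝ≥0∞ := fun k => (∫⁻ y in D k, h y) / volume (D k) with hI
  have hstep : ∀ k ≤ m, ∀ (w : Euc n) (t : ℝ) (Λ : ℝ≥0∞), 0 < t →
      (∀ i, |w i - z k i| + t ≤ a * ρ k) →
      volume (cube (z k) (a * ρ k)) / volume (cube w t) ≤ Λ →
      ‖(⨍ y in cube w t, f y) - ⨍ y in cube (z k) (a * ρ k), f y‖ₑ ≤ Λ * I k := by
    intro k hk w t Λ ht hw hΛ
    refine (hfh.enorm_sub_le_lintegral hf (hzU k hk) (cube_subset_cube hw)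
      (volume_cube_ne_zero w ht) (measurableSet_cube _ _) (hDsub k) (hD0 k)).trans ?_
    gcongr
  have hself : ∀ k ≤ m, ‖(⨍ y in cube (z k) (a / 4 * ρ k), f y) -
      ⨍ y in cube (z k) (a * ρ k), f y‖ₑ ≤ 4 ^ n * I k := by
    intro k hk
    have hp := mul_pos ha0 (hρpos k)
    refine hstep k hk _ _ _ (by linarith) (fun i => by simp; linarith) ?_
    refine (volume_cube_div_le _ _ (c := 4) (by norm_num) (by linarith)).trans ?_
    simp
  have hnext : ∀ k < m, ‖(⨍ y in cube (z (k + 1)) (a / 4 * ρ (k + 1)), f y) -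
      ⨍ y in cube (z k) (a * ρ k), f y‖ₑ ≤ 4 ^ n * I k := by
    intro k hk
    have hp := mul_pos ha0 (hρpos k)
    have hp2 : ρ k ≤ ρ (k + 1) := hρmono (Nat.le_succ k)
    refine hstep k hk.le _ _ _ (by nlinarith) (fun i => ?_) ?_
    · have h1 := hγ _ (htk (k + 1) hk) _ (htk k hk.le)
      have h2 := abs_apply_sub_le_dist (z (k + 1)) (z k) i
      rw [sub_sub_sub_cancel_right, abs_of_nonneg (by linarith)] at h1
      have h3 : |z (k + 1) i - z k i| ≤ ρ (k + 1) - ρ k := h2.trans h1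
      rw [hρsucc] at h3 ⊢
      nlinarith [hρpos k]
    · refine (volume_cube_div_le _ _ (c := 4) (by norm_num) (by nlinarith)).trans ?_
      simp
  have hlink : ∀ k < m, ‖(⨍ y in cube (z k) (a / 4 * ρ k), f y) -
      ⨍ y in cube (z (k + 1)) (a / 4 * ρ (k + 1)), f y‖ₑ ≤ K * I k := by
    intro k hk
    refine (enorm_sub_le_add _ (⨍ y in cube (z k) (a * ρ k), f y) _).trans ?_
    refine (add_le_add (hself k hk.le) ?_).trans (b := 4 ^ n * I k + 4 ^ n * I k) ?_
    · rw [← enorm_neg, neg_sub]; exact hnext k hk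
    · rw [← add_mul, ← two_mul]; gcongr; exact le_self_add
  -- the last cube
  have hr₀s : r₀ ≤ 6 * n * ρ m := by
    have h1 := le_infDist_of_ball_subset hne hγs
    have h2 : Metric.infDist (γ s) Uᶜ ≤ Metric.infDist x Uᶜ + dist (γ s) x :=
      Metric.infDist_le_infDist_add_dist
    have h3 := hγ s ⟨hs, le_rfl⟩ 0 ⟨le_rfl, hs⟩
    rw [hγ0, sub_zero, abs_of_nonneg hs] at h3
    have h4 : l + s ≤ 2 * ρ m := by nlinarith [hρpos m]
    nlinarith
  have hηρ : η ≤ a / 4 * ρ m := by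
    rw [hη, div_le_iff₀ (by positivity)]
    calc a / 4 * r₀ ≤ a / 4 * (6 * n * ρ m) := by gcongr
      _ = _ := by ring
  have hηU : cube (γ s) η ⊆ U := by
    refine (cube_subset_cube_of_le ?_).trans ((cube_div_subset_ball hn (γ s) r₀).trans hγs)
    rw [hη, div_le_div_iff₀ (by positivity) (by positivity)]
    have : 0 < r₀ * n := by positivity
    nlinarith
  have hlast : ‖(⨍ y in cube (z m) (a / 4 * ρ m), f y) - ⨍ y in cube (γ s) η, f y‖ₑ ≤
      K * I m := by
    refine (enorm_sub_le_add _ (⨍ y in cube (z m) (a * ρ m), f y) _).trans ?_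
    rw [hK, add_mul]
    refine add_le_add ((hself m le_rfl).trans ?_) ?_
    · gcongr; rw [two_mul]; exact le_self_add
    · rw [← enorm_neg, neg_sub]
      refine hstep m le_rfl _ _ _ hη0 (fun i => ?_) ?_
      · have h1 := hγ s ⟨hs, le_rfl⟩ _ (htk m le_rfl)
        have h2 := abs_apply_sub_le_dist (γ s) (z m) i
        rw [abs_of_nonneg (by linarith)] at h1
        have h3 : |γ s i - z m i| ≤ s - (ρ m - l) := h2.trans h1
        nlinarith [mul_pos ha0 (hρpos m)]
      · rw [volume_cube (γ s), ← volume_cube (0 : Euc n)]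
        gcongr
        exact hzU m le_rfl
  have hsum : ‖(⨍ y in cube x (a / 4 * l), f y) - ⨍ y in cube (γ s) η, f y‖ₑ ≤
      K * ∑ k ∈ Finset.range (m + 1), I k := by
    rw [Finset.sum_range_succ, mul_add, Finset.mul_sum]
    have h1 := enorm_sub_le_sum_range (fun k => ⨍ y in cube (z k) (a / 4 * ρ k), f y) m
    simp only [hz0, hρ0] at h1
    refine (enorm_sub_le_add _ (⨍ y in cube (z m) (a / 4 * ρ m), f y) _).trans ?_
    refine add_le_add (h1.trans (Finset.sum_le_sum fun k hk => ?_)) hlast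
    exact hlink k (Finset.mem_range.1 hk)
  have hop : ∑ k ∈ Finset.range (m + 1), I k ≤ C₁ * coneOp U (4 * n / a) h x := by
    have h1 : ∀ k ∈ Finset.range (m + 1), I k = ∫⁻ y in U, h y *
        (D k).indicator (fun _ => (volume (D k))⁻¹) y := by
      intro k hk
      have hkm : k ≤ m := Nat.lt_succ_iff.1 (Finset.mem_range.1 hk)
      have h2 : (fun y => h y * (D k).indicator (fun _ => (volume (D k))⁻¹) y) =
          (D k).indicator fun y => h y * (volume (D k))⁻¹ := by
        ext y; by_cases hy : y ∈ D k <;> simp [hy]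
      rw [h2, lintegral_indicator (measurableSet_cube _ _), Measure.restrict_restrict
        (measurableSet_cube _ _), inter_eq_left.2 ((hDsub k).trans (hzU k hkm)),
        lintegral_mul_const _ hhm, ← div_eq_mul_inv]
    have h2 : ∀ k ∈ Finset.range (m + 1),
        Measurable fun y => h y * (D k).indicator (fun _ => (volume (D k))⁻¹) y := fun k _ =>
      hhm.mul (measurable_const.indicator (measurableSet_cube _ _))
    rw [Finset.sum_congr rfl h1, ← lintegral_finsetSum _ h2, coneOp, ← lintegral_const_mul' _ _ hC₁]
    refine lintegral_mono fun y => ?_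
    simp only
    rw [← Finset.mul_sum, mul_left_comm]
    gcongr
    exact H₁ x l m z hl hxd hzx hzU y
  refine (enorm_sub_le_add _ (⨍ y in cube (γ s) η, f y) _).trans ?_
  refine (add_le_add hsum (H₂ (γ s) hηU f h hf hfh)).trans ?_
  calc _ ≤ K * (C₁ * coneOp U (4 * n / a) h x) + C₂ * ∫⁻ y in U, h y := by gcongr
    _ ≤ (K * C₁ + C₂) * coneOp U (4 * n / a) h x + (K * C₁ + C₂) * ∫⁻ y in U, h y := by
      rw [← mul_assoc]
      exact add_le_add (mul_le_mul_left le_self_add _) (mul_le_mul_left le_add_self _)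
    _ = _ := by rw [mul_add]

/-! ### Grid cubes -/

/-- The index of the cube of the grid with mesh `l` that contains `x`. -/
noncomputable def gridIndex {n : ℕ} (l : ℝ) (x : Euc n) : Fin n → ℤ := fun i => ⌊x i / l⌋

/-- The half-open cube with index `v` of the grid with mesh `l`. -/
def gridCube {n : ℕ} (l : ℝ) (v : Fin n → ℤ) : Set (Euc n) := {y | gridIndex l y = v}

/-- The centre of the cube with index `v` of the grid with mesh `l`. -/
noncomputable def gridCenter {n : ℕ} (l : ℝ) (v : Fin n → ℤ) : Euc n :=
  WithLp.toLp 2 fun i => (v i + 1 / 2) * l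

theorem mem_gridCube_gridIndex {n : ℕ} (l : ℝ) (x : Euc n) : x ∈ gridCube l (gridIndex l x) := rfl

theorem abs_sub_gridCenter_le {n : ℕ} {l : ℝ} (hl : 0 < l) {v : Fin n → ℤ} {x : Euc n}
    (hx : x ∈ gridCube l v) (i : Fin n) : |x i - gridCenter l v i| ≤ l / 2 := by
  have h : ⌊x i / l⌋ = v i := congrFun hx i
  rw [Int.floor_eq_iff, le_div_iff₀ hl, div_lt_iff₀ hl] at h
  simp only [gridCenter, abs_le]
  constructor <;> nlinarith [h.1, h.2]

theorem cube_gridCenter_subset {n : ℕ} {l : ℝ} (hl : 0 < l) (v : Fin n → ℤ) :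
    cube (gridCenter l v) (l / 2) ⊆ gridCube l v := by
  intro y hy
  funext i
  have h := hy i
  simp only [gridCenter, abs_lt] at h
  simp only [gridIndex]
  rw [Int.floor_eq_iff, le_div_iff₀ hl, div_lt_iff₀ hl]
  constructor <;> nlinarith [h.1, h.2]

theorem gridCube_subset_cube {n : ℕ} {l : ℝ} (hl : 0 < l) (v : Fin n → ℤ) :
    gridCube l v ⊆ cube (gridCenter l v) l := fun _ hx i => by
  have := abs_sub_gridCenter_le hl hx i; linarith

theorem measurableSet_gridCube {n : ℕ} (l : ℝ) (v : Fin n → ℤ) :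
    MeasurableSet (gridCube (n := n) l v) := by
  have : Measurable (gridIndex (n := n) l) := by
    refine measurable_pi_lambda _ fun i => ?_
    exact Int.measurable_floor.comp (by fun_prop)
  exact this (measurableSet_singleton v)

theorem volume_gridCube_ne_zero {n : ℕ} {l : ℝ} (hl : 0 < l) (v : Fin n → ℤ) :
    volume (gridCube (n := n) l v) ≠ 0 := fun h =>
  volume_cube_ne_zero _ (half_pos hl) (measure_mono_null (cube_gridCenter_subset hl v) h)

theorem volume_cube_div_gridCube_le {n : ℕ} {l : ℝ} (hl : 0 < l) (v : Fin n → ℤ) (z : Euc n)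
    {c r : ℝ} (hc : 0 ≤ c) (hr : r ≤ c * l) :
    volume (cube z r) / volume (gridCube (n := n) l v) ≤ ENNReal.ofReal (2 * c) ^ n := by
  refine le_trans ?_ (volume_cube_div_le z (gridCenter l v) (r := r) (s := l / 2) (c := 2 * c)
    (by positivity) (by linarith))
  gcongr
  exact cube_gridCenter_subset hl v

theorem gridIndex_two_mul {n : ℕ} {l : ℝ} {x y : Euc n} (h : gridIndex l x = gridIndex l y) :
    gridIndex (2 * l) x = gridIndex (2 * l) y := by
  funext i
  have h1 : ⌊x i / l⌋ = ⌊y i / l⌋ := congrFun h i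
  have h2 : ∀ z : ℝ, ⌊z / (2 * l)⌋ = ⌊z / l⌋ / 2 := fun z => by
    rw [mul_comm, ← div_div]
    exact_mod_cast Int.floor_div_natCast (z / l) 2
  simp only [gridIndex, h2, h1]

theorem gridIndex_div_two_pow {n : ℕ} {R : ℝ} {x y : Euc n} {j k : ℕ} (hjk : j ≤ k)
    (h : gridIndex (R / 2 ^ k) x = gridIndex (R / 2 ^ k) y) :
    gridIndex (R / 2 ^ j) x = gridIndex (R / 2 ^ j) y := by
  induction k, hjk using Nat.le_induction with
  | base => exact h
  | succ k _ ih =>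
    refine ih ?_
    have h1 := gridIndex_two_mul h
    have h2 : 2 * (R / 2 ^ (k + 1)) = R / 2 ^ k := by rw [pow_succ]; field_simp
    rwa [h2] at h1

/-- Lebesgue differentiation along grid cubes. -/
theorem ae_tendsto_avg_gridCube {n : ℕ} (hn : 0 < n) {f : Euc n → ℝ} (hf : LocallyIntegrable f)
    {R : ℝ} (hR : 0 < R) : ∀ᵐ x : Euc n, Filter.Tendsto (fun k : ℕ =>
      ‖(⨍ y in gridCube (R / 2 ^ k) (gridIndex (R / 2 ^ k) x), f y) - f x‖ₑ)
      Filter.atTop (nhds 0) := by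
  filter_upwards [IsUnifLocDoublingMeasure.ae_tendsto_average_norm_sub (μ := volume) hf 1] with x hx
  have hn0 : (0 : ℝ) < n := by exact_mod_cast hn
  have hl : ∀ k : ℕ, 0 < R / 2 ^ k := fun k => by positivity
  have hlim0 : Filter.Tendsto (fun k : ℕ => n * (R / 2 ^ k)) Filter.atTop (nhds 0) := by
    have h1 : Filter.Tendsto (fun k : ℕ => (1 / 2 : ℝ) ^ k) Filter.atTop (nhds 0) :=
      tendsto_pow_atTop_nhds_zero_of_lt_one (by norm_num) (by norm_num)
    have h2 := h1.const_mul (n * R)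
    rw [mul_zero] at h2
    refine h2.congr fun k => ?_
    rw [one_div, inv_pow]; ring
  have hlim : Filter.Tendsto (fun k : ℕ => n * (R / 2 ^ k)) Filter.atTop (nhdsWithin 0 (Ioi 0)) :=
    tendsto_nhdsWithin_iff.2 ⟨hlim0, Filter.Eventually.of_forall fun k => mul_pos hn0 (hl k)⟩
  have h1 := hx (fun _ => x) _ hlim (Filter.Eventually.of_forall fun k =>
    Metric.mem_closedBall_self (by have := mul_pos hn0 (hl k); linarith))
  have h2 := (ENNReal.tendsto_ofReal h1)
  rw [ENNReal.ofReal_zero] at h2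
  have h3 := ENNReal.Tendsto.const_mul (a := ENNReal.ofReal (2 * (2 * n)) ^ n) h2
    (Or.inr (by finiteness))
  rw [mul_zero] at h3
  refine tendsto_of_tendsto_of_tendsto_of_le_of_le tendsto_const_nhds h3 (fun _ => zero_le) ?_
  intro k
  set l := R / 2 ^ k with hlk
  have hl0 : 0 < l := hl k
  -- Grid cubes need not be centred at `x`, but they have bounded eccentricity: this ball has at
  -- most `(4n)^n` times their measure, so differentiation along balls suffices.
  have hsub : gridCube l (gridIndex l x) ⊆ Metric.closedBall x (n * l) := fun y hy =>
    dist_le_of_forall_abs_le fun i => by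
      have e1 := abs_sub_gridCenter_le hl0 hy i
      have e2 := abs_sub_gridCenter_le hl0 (mem_gridCube_gridIndex l x) i
      rw [abs_le] at *
      constructor <;> linarith [e1.1, e1.2, e2.1, e2.2]
  have hBtop : volume (Metric.closedBall x (n * l)) ≠ ∞ := measure_closedBall_lt_top.ne
  have hfB : IntegrableOn f (Metric.closedBall x (n * l)) :=
    hf.integrableOn_isCompact (isCompact_closedBall x _)
  have hB0 : volume (Metric.closedBall x (n * l)) ≠ 0 :=
    (Metric.measure_closedBall_pos volume x (mul_pos hn0 hl0)).ne'
  have hint : Integrable (fun y => f y - f x) (volume.restrict (Metric.closedBall x (n * l))) :=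
    hfB.sub (integrableOn_const hBtop)
  refine (enorm_setAverage_sub_le hsub (volume_gridCube_ne_zero hl0 _) hBtop hfB (f x)).trans ?_
  have h4 : ENNReal.ofReal (⨍ y in Metric.closedBall x (n * l), ‖f y - f x‖) =
      (∫⁻ y in Metric.closedBall x (n * l), ‖f y - f x‖ₑ) /
        volume (Metric.closedBall x (n * l)) := by
    rw [setAverage_eq, smul_eq_mul, ENNReal.ofReal_mul (by positivity),
      ← ofReal_integral_norm_eq_lintegral_enorm hint, measureReal_def,
      ENNReal.ofReal_inv_of_pos (ENNReal.toReal_pos hB0 hBtop), ENNReal.ofReal_toReal hBtop,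
      mul_comm, div_eq_mul_inv]
  change _ ≤ ENNReal.ofReal (2 * (2 * n)) ^ n *
    ENNReal.ofReal (⨍ y in Metric.closedBall x (n * l), ‖f y - f x‖)
  rw [h4]
  have h5 : volume (Metric.closedBall x (n * l)) / volume (gridCube l (gridIndex l x)) ≤
      ENNReal.ofReal (2 * (2 * n)) ^ n := by
    refine le_trans ?_ (volume_cube_div_gridCube_le hl0 (gridIndex l x) x (c := 2 * n)
      (by positivity) le_rfl)
    gcongr
    refine (Metric.closedBall_subset_ball ?_).trans (ball_subset_cube _ _)
    nlinarith [mul_pos hn0 hl0]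
  calc _ = volume (Metric.closedBall x (n * l)) / volume (gridCube l (gridIndex l x)) *
        ((∫⁻ y in Metric.closedBall x (n * l), ‖f y - f x‖ₑ) /
        volume (Metric.closedBall x (n * l))) := by
        rw [div_eq_mul_inv, div_eq_mul_inv, div_eq_mul_inv, mul_mul_mul_comm,
          mul_comm (volume (Metric.closedBall x (n * l))), mul_mul_mul_comm,
          ENNReal.mul_inv_cancel hB0 hBtop, mul_one, mul_comm]
    _ ≤ _ := by gcongr

/-! ### The Calderón-Zygmund stopping argument -/

section GridEstimates

variable {n : ℕ} {U : Set (Euc n)} {f : Euc n → ℝ} {h : Euc n → ℝ≥0∞}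

/-- The open cube is the concentric double of the half-open grid cube, so the oscillation bound for
open cubes transfers at the cost of the volume ratio `2^n`. -/
theorem OscBound.enorm_gridAvg_sub_le (hfh : OscBound U f h) (hf : IntegrableOn f U) {l : ℝ}
    (hl : 0 < l) {v : Fin n → ℤ} (hv : cube (gridCenter l v) l ⊆ U) {x : Euc n}
    (hx : x ∈ gridCube l v) :
    ‖(⨍ y in gridCube l v, f y) - ⨍ y in cube (gridCenter l v) l, f y‖ₑ ≤ 2 ^ n * h x := by
  refine (hfh.enorm_sub_le hf hv (gridCube_subset_cube hl v) (volume_gridCube_ne_zero hl v)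
    (gridCube_subset_cube hl v hx)).trans ?_
  gcongr
  refine (volume_cube_div_gridCube_le hl v _ (c := 1) zero_le_one (by linarith)).trans ?_
  simp

theorem volume_gridCube_ne_top {l : ℝ} (hl : 0 < l) (v : Fin n → ℤ) :
    volume (gridCube (n := n) l v) ≠ ∞ :=
  ne_top_of_le_ne_top (volume_cube_ne_top _ _) (measure_mono (gridCube_subset_cube hl v))

theorem OscBound.lintegral_gridCube_le (hfh : OscBound U f h) (hf : IntegrableOn f U) {l : ℝ}
    (hl : 0 < l) {v : Fin n → ℤ} (hv : cube (gridCenter l v) l ⊆ U) {x : Euc n}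
    (hx : x ∈ gridCube l v) :
    ∫⁻ y in gridCube l v, ‖f y - ⨍ w in gridCube l v, f w‖ₑ ≤
      2 * 2 ^ n * h x * volume (gridCube l v) := by
  set Q := gridCube l v
  set C := cube (gridCenter l v) l
  have hQC : Q ⊆ C := gridCube_subset_cube hl v
  have hvol : volume C ≤ 2 ^ n * volume Q := by
    have h1 := volume_cube_div_gridCube_le hl v (gridCenter l v) (c := 1) (r := l) zero_le_one
      (by linarith)
    rw [ENNReal.div_le_iff (volume_gridCube_ne_zero hl v) (volume_gridCube_ne_top hl v)] at h1
    simpa using h1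
  calc ∫⁻ y in Q, ‖f y - ⨍ w in Q, f w‖ₑ
      ≤ ∫⁻ y in Q, (‖f y - ⨍ w in C, f w‖ₑ + ‖(⨍ w in C, f w) - ⨍ w in Q, f w‖ₑ) :=
        lintegral_mono fun y => enorm_sub_le_add _ _ _
    _ = (∫⁻ y in Q, ‖f y - ⨍ w in C, f w‖ₑ) +
        ‖(⨍ w in C, f w) - ⨍ w in Q, f w‖ₑ * volume Q := by
        rw [lintegral_add_right _ measurable_const, setLIntegral_const]
    _ ≤ 2 ^ n * h x * volume Q + 2 ^ n * h x * volume Q := by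
        gcongr
        · refine (lintegral_mono_set hQC).trans ((hfh _ _ hv x (hQC hx)).trans ?_)
          calc h x * volume C ≤ h x * (2 ^ n * volume Q) := by gcongr
            _ = _ := by ring
        · rw [← enorm_neg, neg_sub]
          exact hfh.enorm_gridAvg_sub_le hf hl hv hx
    _ = _ := by ring

theorem le_add_of_enorm_sub_le {a b : ℝ} {c d : ℝ≥0∞} (h : ‖a - b‖ₑ ≤ c) (hb : ‖b‖ₑ ≤ d) :
    ‖a‖ₑ ≤ d + c := by
  calc ‖a‖ₑ = ‖b + (a - b)‖ₑ := by congr 1; ring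
    _ ≤ ‖b‖ₑ + ‖a - b‖ₑ := enorm_add_le _ _
    _ ≤ _ := by gcongr

/-- Both parent and child lie in the double of the parent, with volume ratios `2^n` and `4^n`. -/
theorem OscBound.enorm_gridAvg_le_of_parent (hfh : OscBound U f h) (hf : IntegrableOn f U) {l : ℝ}
    (hl : 0 < l) {x : Euc n}
    (hP : cube (gridCenter (2 * l) (gridIndex (2 * l) x)) (2 * l) ⊆ U) {t : ℝ≥0∞}
    (ht : ‖⨍ y in gridCube (2 * l) (gridIndex (2 * l) x), f y‖ₑ ≤ t) :
    ‖⨍ y in gridCube l (gridIndex l x), f y‖ₑ ≤ t + (2 ^ n + 4 ^ n) * h x := by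
  have hl2 : 0 < 2 * l := by positivity
  have hQP : gridCube l (gridIndex l x) ⊆ gridCube (2 * l) (gridIndex (2 * l) x) :=
    fun y hy => gridIndex_two_mul hy
  have h1 := hfh.enorm_gridAvg_sub_le hf hl2 hP (mem_gridCube_gridIndex _ x)
  rw [← enorm_neg, neg_sub] at h1
  have h2 := le_add_of_enorm_sub_le h1 ht
  have h3 := hfh.enorm_sub_le hf hP (hQP.trans (gridCube_subset_cube hl2 _))
    (volume_gridCube_ne_zero hl _) (gridCube_subset_cube hl2 _ (mem_gridCube_gridIndex _ x))
  have h4 := volume_cube_div_gridCube_le hl (gridIndex l x)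
    (gridCenter (2 * l) (gridIndex (2 * l) x)) (c := 2) (r := 2 * l) zero_le_two le_rfl
  have h5 : ENNReal.ofReal (2 * 2) = 4 := by norm_num
  rw [h5] at h4
  refine (le_add_of_enorm_sub_le h3 h2).trans ?_
  rw [add_mul, ← add_assoc]
  gcongr

theorem OscBound.enorm_gridAvg_le_of_cubeAvg (hfh : OscBound U f h) (hf : IntegrableOn f U) {l : ℝ}
    (hl : 0 < l) {x : Euc n} (hQ : cube (gridCenter l (gridIndex l x)) l ⊆ U) {a : ℝ} (ha : 0 < a)
    (ha1 : a ≤ 1 / 2) {t : ℝ≥0∞} (ht : ‖⨍ y in cube x (a * l), f y‖ₑ ≤ t) :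
    ‖⨍ y in gridCube l (gridIndex l x), f y‖ₑ ≤
      t + (ENNReal.ofReal (1 / a) ^ n + 2 ^ n) * h x := by
  have hal : 0 < a * l := by positivity
  have h1 := hfh.enorm_gridAvg_sub_le hf hl hQ (mem_gridCube_gridIndex _ x)
  have hsub : cube x (a * l) ⊆ cube (gridCenter l (gridIndex l x)) l :=
    cube_subset_cube fun i => by
      have := abs_sub_gridCenter_le hl (mem_gridCube_gridIndex l x) i
      nlinarith
  have h2 := hfh.enorm_sub_le hf hQ hsub (volume_cube_ne_zero x hal)
    (gridCube_subset_cube hl _ (mem_gridCube_gridIndex _ x))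
  rw [← enorm_neg, neg_sub] at h2
  have h3 := volume_cube_div_le (gridCenter l (gridIndex l x)) x (c := 1 / a) (r := l) (s := a * l)
    (by positivity) (by field_simp; rfl)
  refine (le_add_of_enorm_sub_le h1 (le_add_of_enorm_sub_le h2 ht)).trans ?_
  rw [add_mul, ← add_assoc]
  gcongr

end GridEstimates

/-- If the average of `f` over a grid cube exceeds `t` by at most a multiple of `H`, then the
excess of `|f|` over `t` is controlled in the mean by `H`. -/
theorem OscBound.lintegral_sub_gridCube_le {n : ℕ} {U : Set (Euc n)} {f : Euc n → ℝ}
    {h H : Euc n → ℝ≥0∞} (hfh : OscBound U f h) (hf : IntegrableOn f U) {l : ℝ}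
    (hl : 0 < l) {v : Fin n → ℤ} (hv : cube (gridCenter l v) l ⊆ U) {t K : ℝ≥0∞} (hK : K ≠ ∞)
    (hhH : ∀ x, h x ≤ H x)
    (H₁ : ∀ x ∈ gridCube l v, ‖⨍ w in gridCube l v, f w‖ₑ ≤ t + K * H x) :
    ∫⁻ y in gridCube l v, (‖f y‖ₑ - t) ≤
      (2 * 2 ^ n + K) * ∫⁻ y in gridCube l v, H y := by
  set Q := gridCube l v with hQ
  have h1 : ∀ x ∈ Q, ∫⁻ y in Q, (‖f y‖ₑ - t) ≤ (2 * 2 ^ n + K) * H x * volume Q := by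
    intro x hx
    calc ∫⁻ y in Q, (‖f y‖ₑ - t) ≤ ∫⁻ y in Q, (‖f y - ⨍ w in Q, f w‖ₑ + K * H x) := by
          refine lintegral_mono fun y => ?_
          rw [tsub_le_iff_left, add_left_comm, add_comm ‖_‖ₑ]
          exact le_add_of_enorm_sub_le le_rfl (H₁ x hx)
      _ = (∫⁻ y in Q, ‖f y - ⨍ w in Q, f w‖ₑ) + K * H x * volume Q := by
          rw [lintegral_add_right _ measurable_const, setLIntegral_const]
      _ ≤ 2 * 2 ^ n * H x * volume Q + K * H x * volume Q := by
          gcongr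
          refine (hfh.lintegral_gridCube_le hf hl hv hx).trans ?_
          gcongr
          exact hhH x
      _ = _ := by ring
  have hQ0 := volume_gridCube_ne_zero hl v
  have hQtop := volume_gridCube_ne_top hl v
  rw [← lintegral_const_mul' _ _ (by finiteness)]
  calc ∫⁻ y in Q, (‖f y‖ₑ - t) = (∫⁻ y in Q, (‖f y‖ₑ - t)) / volume Q * volume Q := by
        rw [ENNReal.div_mul_cancel hQ0 hQtop]
    _ = ∫⁻ x in Q, (∫⁻ y in Q, (‖f y‖ₑ - t)) / volume Q := by rw [setLIntegral_const]
    _ ≤ _ := by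
        refine setLIntegral_mono' (measurableSet_gridCube l v) fun x hx => ?_
        exact ENNReal.div_le_of_le_mul (h1 x hx)

/-- Calderón-Zygmund stopping at height `t`. There is no single top cube; the hypothesis `HA`
replaces the smallness of its average, by bounding averages at scales comparable to the distance to
the complement. -/
theorem OscBound.lintegral_superlevel_le {n : ℕ} (hn : 0 < n) {U : Set (Euc n)} (hU : IsOpen U)
    (hb : Bornology.IsBounded U) {f : Euc n → ℝ} {h A : Euc n → ℝ≥0∞} (hfh : OscBound U f h)
    (hfm : Measurable f) (hf : LocallyIntegrable f) {a : ℝ} (ha : 0 < a) (ha1 : a ≤ 1 / 2)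
    (HA : ∀ x ∈ U, ∀ l : ℝ, 0 < l → cube x (l / 2) ⊆ U → Metric.infDist x Uᶜ ≤ 3 * n * l →
      ‖⨍ y in cube x (a * l), f y‖ₑ ≤ A x) {t : ℝ≥0∞} (ht : t ≠ ∞) :
    ∫⁻ y in U ∩ {y | 2 * t < ‖f y‖ₑ}, ‖f y‖ₑ ≤
      2 * (2 * 2 ^ n + (2 ^ n + 4 ^ n + ENNReal.ofReal (1 / a) ^ n + 1)) *
      ∫⁻ y in U ∩ {y | t < 2 ^ n * maxFn (U.indicator fun y => ‖f y‖ₑ) y}, (h y + A y) := by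
  have hn1 : (1 : ℝ) ≤ n := by exact_mod_cast hn
  have hfU : IntegrableOn f U :=
    (hf.integrableOn_isCompact hb.isCompact_closure).mono_set subset_closure
  set K : ℝ≥0∞ := 2 ^ n + 4 ^ n + ENNReal.ofReal (1 / a) ^ n + 1 with hK
  have hKtop : K ≠ ∞ := by finiteness
  -- an upper bound for the distance to the complement
  obtain ⟨R, hR0, hR⟩ : ∃ R : ℝ, 0 < R ∧ ∀ x ∈ U, Metric.infDist x Uᶜ ≤ R := by
    rcases Uᶜ.eq_empty_or_nonempty with he | ⟨p, hp⟩
    · exact ⟨1, one_pos, fun x _ => by simp [he]⟩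
    · obtain ⟨r, hr⟩ := hb.subset_closedBall p
      refine ⟨max r 1, by positivity, fun x hx => ?_⟩
      exact (Metric.infDist_le_dist_of_mem hp).trans ((hr hx).trans (le_max_left _ _))
  let l : ℕ → ℝ := fun k => R / 2 ^ k
  have hl : ∀ k, 0 < l k := fun k => by positivity
  have hlsucc : ∀ k, 2 * l (k + 1) = l k := fun k => by
    simp only [l]; rw [pow_succ]; field_simp
  let sel : ℕ → (Fin n → ℤ) → Prop := fun k v =>
    cube (gridCenter (l k) v) (l k) ⊆ U ∧ t < ‖⨍ y in gridCube (l k) v, f y‖ₑ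
  let firstSel : ℕ → Euc n → Prop := fun k x =>
    sel k (gridIndex (l k) x) ∧ ∀ j < k, ¬ sel j (gridIndex (l j) x)
  have hstop_congr : ∀ k x y, gridIndex (l k) x = gridIndex (l k) y → firstSel k x →
      firstSel k y := by
    intro k x y hxy hx
    refine ⟨hxy ▸ hx.1, fun j hj hs => hx.2 j hj ?_⟩
    rwa [gridIndex_div_two_pow hj.le hxy]
  have hstop_unique : ∀ k k' x, firstSel k x → firstSel k' x → k = k' := by
    intro k k' x hk hk'
    rcases lt_trichotomy k k' with hlt | heq | hlt
    · exact absurd hk.1 (hk'.2 k hlt)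
    · exact heq
    · exact absurd hk'.1 (hk.2 k' hlt)
  -- Points in one grid cube share all coarser grid cubes, so being first selected is a property of
  -- the cube; these maximal cubes are disjoint.
  let T : Set (ℕ × (Fin n → ℤ)) := {b | ∀ x ∈ gridCube (l b.1) b.2, firstSel b.1 x}
  set Ω : Set (Euc n) := ⋃ b ∈ T, gridCube (l b.1) b.2 with hΩ
  have hmem : ∀ x, (∃ k, sel k (gridIndex (l k) x)) → x ∈ Ω := by
    classical
    intro x hx
    refine mem_biUnion (x := (Nat.find hx, gridIndex (l (Nat.find hx)) x)) (fun y hy => ?_)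
      (mem_gridCube_gridIndex _ x)
    exact hstop_congr _ x y hy.symm ⟨Nat.find_spec hx, fun j hj => Nat.find_min hx hj⟩
  have hselT : ∀ b ∈ T, sel b.1 b.2 := by
    intro b hb
    have hc : gridCenter (l b.1) b.2 ∈ gridCube (l b.1) b.2 :=
      cube_gridCenter_subset (hl _) _ (mem_cube_self _ (half_pos (hl _)))
    have h1 := (hb _ hc).1
    rwa [show gridIndex (l b.1) (gridCenter (l b.1) b.2) = b.2 from hc] at h1
  have hdisj : T.PairwiseDisjoint fun b => gridCube (n := n) (l b.1) b.2 := by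
    intro b hb b' hb' hne
    refine Set.disjoint_left.2 fun x hx hx' => hne ?_
    have h1 : b.1 = b'.1 := hstop_unique _ _ x (hb x hx) (hb' x hx')
    refine Prod.ext h1 ?_
    have h2 : gridIndex (l b.1) x = b.2 := hx
    have h3 : gridIndex (l b'.1) x = b'.2 := hx'
    rw [← h2, ← h3, h1]
  -- on the stopping cubes
  have hcube : ∀ b ∈ T, ∫⁻ y in gridCube (l b.1) b.2, (‖f y‖ₑ - t) ≤
      (2 * 2 ^ n + K) * ∫⁻ y in gridCube (l b.1) b.2, (h y + A y) := by
    rintro ⟨k, v⟩ hb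
    refine hfh.lintegral_sub_gridCube_le hfU (hl k) (hselT _ hb).1 hKtop
      (fun x => le_self_add) fun x hx => ?_
    have hxv : gridIndex (l k) x = v := hx
    have hst : firstSel k x := hb x hx
    obtain ⟨⟨hgood, -⟩, hmin⟩ := hst
    rw [← hxv]
    have hxU : x ∈ U := hgood (gridCube_subset_cube (hl k) _ (mem_gridCube_gridIndex _ x))
    have htop : Metric.infDist x Uᶜ ≤ 3 * n * l k →
        ‖⨍ w in gridCube (l k) (gridIndex (l k) x), f w‖ₑ ≤ t + K * (h x + A x) := by
      intro hd
      have hxc : cube x (l k / 2) ⊆ U := by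
        refine (cube_subset_cube fun i => ?_).trans hgood
        have := abs_sub_gridCenter_le (hl k) (mem_gridCube_gridIndex (l k) x) i
        linarith
      refine (hfh.enorm_gridAvg_le_of_cubeAvg hfU (hl k) hgood ha ha1
        (HA x hxU _ (hl k) hxc hd)).trans ?_
      calc A x + (ENNReal.ofReal (1 / a) ^ n + 2 ^ n) * h x
          ≤ K * A x + K * h x := by
            refine add_le_add ?_ ?_
            · exact le_mul_of_one_le_left zero_le (by rw [hK]; exact le_add_self)
            · gcongr
              rw [hK, show (2 : ℝ≥0∞) ^ n + 4 ^ n + ENNReal.ofReal (1 / a) ^ n + 1 =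
                (ENNReal.ofReal (1 / a) ^ n + 2 ^ n) + (4 ^ n + 1) by ring]
              exact le_self_add
        _ = K * (h x + A x) := by ring
        _ ≤ _ := le_add_self
    -- At the coarsest level the mesh is `R`, at least every distance to the complement, so the cube
    -- already has Whitney size. Otherwise the parent decides.
    rcases k with _ | k
    · refine htop ((hR x hxU).trans ?_)
      have : l 0 = R := by simp [l]
      rw [this]
      nlinarith
    · by_cases hP : cube (gridCenter (l k) (gridIndex (l k) x)) (l k) ⊆ U
      · have hle : ‖⨍ y in gridCube (l k) (gridIndex (l k) x), f y‖ₑ ≤ t := by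
          by_contra! hcon
          exact hmin k (Nat.lt_succ_self k) ⟨hP, hcon⟩
        rw [← hlsucc] at hP hle
        refine (hfh.enorm_gridAvg_le_of_parent hfU (hl _) hP hle).trans ?_
        gcongr
        · rw [hK, add_assoc]; exact le_self_add
        · exact le_self_add
      · refine htop ?_
        -- A point outside `U` in the double of the parent is within `3/2` parent meshes, that is 3
        -- child meshes, of `x` in each coordinate; hence the constant `3 * n` in `HA`.
        obtain ⟨p, hp, hpU⟩ := not_subset.1 hP
        refine (Metric.infDist_le_dist_of_mem (mem_compl hpU)).trans ?_
        rw [mul_comm 3 (n : ℝ), mul_assoc]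
        refine dist_le_of_forall_abs_le fun i => ?_
        have h1 := hp i
        have h2 := abs_sub_gridCenter_le (hl k) (mem_gridCube_gridIndex (l k) x) i
        have h3 := hlsucc k
        rw [abs_lt] at h1
        rw [abs_le] at h2 ⊢
        constructor <;> linarith [h1.1, h1.2, h2.1, h2.2]
  -- the exceptional set contains almost every point of the superlevel set
  have hae : ∀ᵐ x, x ∈ U ∩ {y | 2 * t < ‖f y‖ₑ} → x ∈ Ω := by
    filter_upwards [ae_tendsto_avg_gridCube hn hf hR0] with x hx hxU
    apply hmem
    by_contra! hcon
    obtain ⟨r, hr, hrU⟩ := exists_cube_subset hn hU hxU.1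
    have hl0 : Filter.Tendsto l Filter.atTop (nhds 0) := by
      have h1 : Filter.Tendsto (fun k : ℕ => (1 / 2 : ℝ) ^ k) Filter.atTop (nhds 0) :=
        tendsto_pow_atTop_nhds_zero_of_lt_one (by norm_num) (by norm_num)
      have h2 := h1.const_mul R
      rw [mul_zero] at h2
      refine h2.congr fun k => ?_
      simp only [l]
      rw [one_div, inv_pow]; ring
    have hev : ∀ᶠ k in Filter.atTop, ‖f x‖ₑ ≤
        t + ‖(⨍ y in gridCube (l k) (gridIndex (l k) x), f y) - f x‖ₑ := by
      filter_upwards [hl0.eventually (gt_mem_nhds (show 0 < r / 2 by positivity))] with k hk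
      have hsub : cube (gridCenter (l k) (gridIndex (l k) x)) (l k) ⊆ U := by
        refine (cube_subset_cube fun i => ?_).trans hrU
        have := abs_sub_gridCenter_le (hl k) (mem_gridCube_gridIndex (l k) x) i
        rw [abs_sub_comm]
        linarith [hl k]
      have hle : ‖⨍ y in gridCube (l k) (gridIndex (l k) x), f y‖ₑ ≤ t := by
        by_contra! hc
        exact hcon k ⟨hsub, hc⟩
      refine le_add_of_enorm_sub_le (le_of_eq ?_) hle
      rw [← enorm_neg, neg_sub]
    have hlim := hx.const_add t
    rw [add_zero] at hlim
    have h1 : ‖f x‖ₑ ≤ t := ge_of_tendsto hlim hev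
    have h2 : 2 * t < ‖f x‖ₑ := hxU.2
    have h3 : t ≤ 2 * t := by rw [two_mul]; exact le_self_add
    exact absurd (h3.trans_lt h2) (not_lt.2 h1)
  -- and it is contained in a superlevel set of the maximal function
  have hΩsub : Ω ⊆ U ∩ {y | t < 2 ^ n * maxFn (U.indicator fun y => ‖f y‖ₑ) y} := by
    refine iUnion₂_subset fun b hb x hx => ?_
    obtain ⟨hgood, hlt⟩ := hselT b hb
    have hxc := gridCube_subset_cube (hl b.1) b.2 hx
    refine ⟨hgood hxc, hlt.trans_le ?_⟩
    have h1 := enorm_setAverage_sub_le (gridCube_subset_cube (hl b.1) b.2)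
      (volume_gridCube_ne_zero (hl b.1) b.2) (volume_cube_ne_top _ _) (hfU.mono_set hgood) 0
    simp only [sub_zero] at h1
    refine h1.trans ?_
    have h2 : ∫⁻ y in cube (gridCenter (l b.1) b.2) (l b.1), ‖f y‖ₑ ≤
        maxFn (U.indicator fun y => ‖f y‖ₑ) x * volume (cube (gridCenter (l b.1) b.2) (l b.1)) := by
      refine le_trans (le_of_eq ?_) (lintegral_le_maxFn_mul _ hxc)
      exact setLIntegral_congr_fun (measurableSet_cube _ _) fun y hy => by simp [hgood hy]
    have h3 := volume_cube_div_gridCube_le (hl b.1) b.2 (gridCenter (l b.1) b.2) (c := 1)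
      (r := l b.1) zero_le_one (by linarith)
    rw [mul_one, ENNReal.ofReal_ofNat] at h3
    calc _ ≤ maxFn (U.indicator fun y => ‖f y‖ₑ) x *
          volume (cube (gridCenter (l b.1) b.2) (l b.1)) / volume (gridCube (l b.1) b.2) := by
          gcongr
      _ = volume (cube (gridCenter (l b.1) b.2) (l b.1)) / volume (gridCube (l b.1) b.2) *
          maxFn (U.indicator fun y => ‖f y‖ₑ) x := by
          rw [mul_div_assoc, mul_comm]
      _ ≤ _ := by gcongr
  have hTc : T.Countable := Set.to_countable T
  -- Passing from `t` to `2 * t` makes the excess over `t` comparable to `|f|` itself.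
  have hpt : ∀ y ∈ {y | 2 * t < ‖f y‖ₑ}, ‖f y‖ₑ ≤ 2 * (‖f y‖ₑ - t) := by
    intro y hy
    have hy' : 2 * t < ‖f y‖ₑ := hy
    rw [ENNReal.mul_sub (by simp)]
    refine ENNReal.le_sub_of_add_le_right (by finiteness) ?_
    rw [two_mul ‖f y‖ₑ]
    gcongr
  have hms : MeasurableSet (U ∩ {y | 2 * t < ‖f y‖ₑ}) :=
    hU.measurableSet.inter (measurableSet_lt measurable_const hfm.enorm)
  calc ∫⁻ y in U ∩ {y | 2 * t < ‖f y‖ₑ}, ‖f y‖ₑ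
      ≤ ∫⁻ y in U ∩ {y | 2 * t < ‖f y‖ₑ}, 2 * (‖f y‖ₑ - t) :=
        setLIntegral_mono' hms fun y hy => hpt y hy.2
    _ ≤ ∫⁻ y in Ω, 2 * (‖f y‖ₑ - t) := lintegral_mono_set' hae
    _ = 2 * ∫⁻ y in Ω, (‖f y‖ₑ - t) := lintegral_const_mul' _ _ (by simp)
    _ = 2 * ∑' b : T, ∫⁻ y in gridCube (l b.1.1) b.1.2, (‖f y‖ₑ - t) := by
        rw [hΩ, lintegral_biUnion hTc (fun b _ => measurableSet_gridCube _ _) hdisj]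
    _ ≤ 2 * ∑' b : T, (2 * 2 ^ n + K) * ∫⁻ y in gridCube (l b.1.1) b.1.2, (h y + A y) := by
        gcongr with b
        exact hcube b.1 b.2
    _ = 2 * (2 * 2 ^ n + K) * ∫⁻ y in Ω, (h y + A y) := by
        rw [ENNReal.tsum_mul_left, hΩ,
          lintegral_biUnion hTc (fun b _ => measurableSet_gridCube _ _) hdisj, mul_assoc]
    _ ≤ _ := by gcongr

/-! ### The `L^q` estimate for bounded functions -/

theorem measurable_uncurry_coneKernel {n : ℕ} (U : Set (Euc n)) (B : ℝ) :
    Measurable fun z : Euc n × Euc n => coneKernel U B z.1 z.2 := by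
  have h1 : Measurable fun z : Euc n × Euc n => Metric.infDist z.2 Uᶜ :=
    (Metric.continuous_infDist_pt Uᶜ).measurable.comp measurable_snd
  have h2 : (fun z : Euc n × Euc n => coneKernel U B z.1 z.2) =
      {z : Euc n × Euc n | dist z.1 z.2 ≤ B * Metric.infDist z.2 Uᶜ}.indicator
        fun z => (ENNReal.ofReal (Metric.infDist z.2 Uᶜ) ^ n)⁻¹ := rfl
  rw [h2]
  refine Measurable.indicator ?_ (measurableSet_le (by fun_prop) (h1.const_mul B))
  exact (h1.ennreal_ofReal.pow_const n).inv

theorem measurable_coneOp {n : ℕ} (U : Set (Euc n)) (B : ℝ) {h : Euc n → ℝ≥0∞}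
    (hh : Measurable h) : Measurable (coneOp U B h) := by
  refine Measurable.lintegral_prod_right' (f := fun z : Euc n × Euc n =>
    h z.2 * coneKernel U B z.1 z.2) ?_
  exact (hh.comp measurable_snd).mul (measurable_uncurry_coneKernel U B)

/-- The adjoint of `coneOp` is dominated by the maximal function. -/
theorem lintegral_coneKernel_mul_le {n : ℕ} {U : Set (Euc n)} (hU : IsOpen U)
    (hne : Uᶜ.Nonempty) {B : ℝ} (hB : 0 < B) (G : Euc n → ℝ≥0∞) {y : Euc n} (hy : y ∈ U) :
    ∫⁻ x in U, coneKernel U B x y * G x ≤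
      ENNReal.ofReal (4 * B) ^ n * maxFn (U.indicator G) y := by
  set d := Metric.infDist y Uᶜ with hd
  have hd0 : 0 < d := by
    obtain ⟨r, hr, hrU⟩ := Metric.isOpen_iff.1 hU y hy
    exact hr.trans_le (le_infDist_of_ball_subset hne hrU)
  set D : ℝ≥0∞ := ENNReal.ofReal d ^ n with hD
  have hD0 : D ≠ 0 := pow_ne_zero _ (by simpa using hd0)
  have hDtop : D ≠ ∞ := by finiteness
  have h1 : ∫⁻ x in U, coneKernel U B x y * G x ≤
      ∫⁻ x in cube y (2 * B * d), D⁻¹ * U.indicator G x := by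
    rw [← lintegral_indicator hU.measurableSet, ← lintegral_indicator (measurableSet_cube _ _)]
    refine lintegral_mono fun x => ?_
    by_cases hx : x ∈ U
    · by_cases hxy : dist x y ≤ B * d
      · have hc : x ∈ cube y (2 * B * d) := ball_subset_cube _ _ (by
          rw [Metric.mem_ball]; nlinarith [mul_pos hB hd0])
        have hk : coneKernel U B x y = D⁻¹ := by
          rw [coneKernel, indicator_of_mem (by exact hxy)]
        simp [hx, hc, hk]
      · have hk : coneKernel U B x y = 0 := by
          rw [coneKernel, indicator_of_notMem (by exact hxy)]
        simp [hx, hk]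
    · simp [hx]
  refine h1.trans ?_
  rw [lintegral_const_mul' _ _ (by simpa using hD0)]
  have h2 := lintegral_le_maxFn_mul (U.indicator G) (mem_cube_self y (r := 2 * B * d)
    (by positivity))
  calc _ ≤ D⁻¹ * (maxFn (U.indicator G) y * volume (cube y (2 * B * d))) := by gcongr
    _ = _ := by
      rw [volume_cube, show 2 * (2 * B * d) = 4 * B * d by ring, ENNReal.ofReal_mul (by positivity),
        mul_pow, ← hD, mul_left_comm, mul_left_comm D⁻¹, ENNReal.inv_mul_cancel hD0 hDtop, mul_one,
        mul_comm]

theorem lintegral_coneOp_mul_le {n : ℕ} {U : Set (Euc n)} (hU : IsOpen U)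
    (hne : Uᶜ.Nonempty) {B : ℝ} (hB : 0 < B) {h G : Euc n → ℝ≥0∞} (hh : Measurable h)
    (hG : Measurable G) :
    ∫⁻ x in U, coneOp U B h x * G x ≤
      ENNReal.ofReal (4 * B) ^ n * ∫⁻ y in U, h y * maxFn (U.indicator G) y := by
  have hk := measurable_uncurry_coneKernel U B
  have h1 : ∀ x, coneOp U B h x * G x = ∫⁻ y in U, h y * (coneKernel U B x y * G x) := by
    intro x
    have hkx : Measurable fun y => coneKernel U B x y :=
      Measurable.of_uncurry_left (f := coneKernel U B) hk
    have hm : Measurable fun y => h y * coneKernel U B x y := hh.mul hkx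
    rw [coneOp, ← lintegral_mul_const (G x) hm]
    exact lintegral_congr fun y => mul_assoc _ _ _
  simp_rw [h1]
  rw [lintegral_lintegral_swap]
  · rw [← lintegral_const_mul' _ _ (by finiteness)]
    refine setLIntegral_mono' hU.measurableSet fun y hy => ?_
    have hky : Measurable fun x => coneKernel U B x y :=
      Measurable.of_uncurry_right (f := coneKernel U B) hk
    have hm : Measurable fun x => coneKernel U B x y * G x := hky.mul hG
    rw [lintegral_const_mul _ hm, mul_left_comm]
    exact mul_le_mul_right (lintegral_coneKernel_mul_le hU hne hB G hy) _
  · have hm : Measurable fun z : Euc n × Euc n => h z.2 * (coneKernel U B z.1 z.2 * G z.1) :=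
      (hh.comp measurable_snd).mul (hk.mul (hG.comp measurable_fst))
    exact hm.aemeasurable

/-- This handles the term `∫ h` of the chain estimate: integration over `U` is its own transpose,
and `U` fits in a cube of fixed size about any of its points. -/
theorem exists_lintegral_le_maxFn {n : ℕ} {U : Set (Euc n)} (hU : MeasurableSet U)
    (hb : Bornology.IsBounded U) :
    ∃ C : ℝ≥0∞, C ≠ ∞ ∧ ∀ (G : Euc n → ℝ≥0∞), ∀ y ∈ U,
      ∫⁻ x in U, G x ≤ C * maxFn (U.indicator G) y := by
  have hD : 0 < Metric.diam U + 1 := by have := Metric.diam_nonneg (s := U); positivity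
  refine ⟨volume (cube (0 : Euc n) (Metric.diam U + 1)), volume_cube_ne_top _ _, fun G y hy => ?_⟩
  have hsub : U ⊆ cube y (Metric.diam U + 1) := fun x hx => ball_subset_cube _ _ (by
    rw [Metric.mem_ball]; linarith [Metric.dist_le_diam_of_mem hb hx hy])
  have h1 := lintegral_le_maxFn_mul (U.indicator G) (mem_cube_self y hD)
  rw [setLIntegral_indicator hU, inter_eq_left.2 hsub] at h1
  rwa [mul_comm, volume_cube, ← volume_cube y]

/-- Absorption: cancelling `X ^ (1/p)` leaves `X ^ (1/q)`. The cancellation is where `X ≠ ∞` is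
indispensable. -/
theorem rpow_le_of_le_mul_rpow_mul_rpow {X I K : ℝ≥0∞} {q p : ℝ} (hqp : q.HolderConjugate p)
    (hX : X ≠ ∞) (h : X ≤ K * (I ^ (1 / q) * X ^ (1 / p))) : X ≤ K ^ q * I := by
  rcases eq_or_ne X 0 with rfl | hX0
  · exact zero_le
  have hq := hqp.pos
  have hp := hqp.symm.pos
  have h1 : X = X ^ (1 / q) * X ^ (1 / p) := by
    rw [← ENNReal.rpow_add _ _ hX0 hX, hqp.one_div_add_one_div, div_one, ENNReal.rpow_one]
  have hXp : X ^ (1 / p) ≠ 0 := by simp [hX0, hX]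
  have hXp' : X ^ (1 / p) ≠ ∞ := ENNReal.rpow_ne_top_of_nonneg (by positivity) hX
  have h2 : X ^ (1 / q) ≤ K * I ^ (1 / q) := by
    rw [← ENNReal.mul_le_mul_iff_left hXp hXp', ← h1, mul_assoc]
    exact h
  calc X = (X ^ (1 / q)) ^ q := by rw [← ENNReal.rpow_mul]; simp [hq.ne']
    _ ≤ (K * I ^ (1 / q)) ^ q := by gcongr
    _ = K ^ q * I := by
      rw [ENNReal.mul_rpow_of_nonneg _ _ hq.le, ← ENNReal.rpow_mul]; simp [hq.ne']

/-- Layer cake with exponent `q - 1` on both sides, with weights `F` and `H`; the factor `2 ^ (q -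
1)` pays for the doubled height. -/
theorem lintegral_rpow_le_of_superlevel {α : Type*} [MeasurableSpace α] {μ : Measure α} [SFinite μ]
    {F M H : α → ℝ≥0∞} (hF : Measurable F) (hM : Measurable M) (hH : Measurable H) {q : ℝ}
    (hq : 1 < q) {C : ℝ≥0∞} (hC : C ≠ ∞)
    (h : ∀ t : ℝ, 0 < t → ∫⁻ x in {x | 2 * ENNReal.ofReal t < F x}, F x ∂μ ≤
      C * ∫⁻ x in {x | ENNReal.ofReal t < M x}, H x ∂μ) :
    ∫⁻ x, F x ^ q ∂μ ≤ 2 ^ (q - 1) * C * ∫⁻ x, H x * M x ^ (q - 1) ∂μ := by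
  have hq1 : 0 < q - 1 := by linarith
  have h1 : ∫⁻ x, F x ^ q ∂μ = 2 ^ (q - 1) * ∫⁻ x, F x * (F x / 2) ^ (q - 1) ∂μ := by
    rw [← lintegral_const_mul _ (by fun_prop)]
    refine lintegral_congr fun x => ?_
    rw [mul_left_comm, ← ENNReal.mul_rpow_of_nonneg _ _ hq1.le,
      ENNReal.mul_div_cancel (by simp) (by simp)]
    conv_lhs => rw [show q = 1 + (q - 1) by ring]
    rw [ENNReal.rpow_add_of_nonneg _ _ zero_le_one hq1.le, ENNReal.rpow_one]
  rw [h1, mul_assoc]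
  refine mul_le_mul_right ?_ _
  rw [lintegral_mul_rpow_eq_layercake hF (by fun_prop) hq1,
    lintegral_mul_rpow_eq_layercake hH hM hq1, mul_left_comm]
  refine mul_le_mul_right ?_ _
  rw [← lintegral_const_mul' _ _ hC]
  refine setLIntegral_mono' measurableSet_Ioi fun t ht => ?_
  rw [mul_left_comm]
  refine mul_le_mul_right ?_ _
  refine le_trans (le_of_eq ?_) (h t ht)
  congr 2
  ext x
  rw [mem_ofPred_eq, mem_ofPred_eq, ENNReal.lt_div_iff_mul_lt (by simp) (by simp), mul_comm]

theorem TwistedConeCondition.exists_bounded_lintegral_le {n : ℕ} (hn : 0 < n) {U : Set (Euc n)}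
    (hU : IsOpen U) (hc : IsPreconnected U) (hb : Bornology.IsBounded U)
    (hcone : TwistedConeCondition U) {x₀ : Euc n} (hx₀ : x₀ ∈ U) {R₀ : ℝ}
    (hR₀ : 0 < R₀) (hx₀R : cube x₀ R₀ ⊆ U) {q : ℝ} (hq : 1 < q) :
    ∃ C : ℝ≥0∞, C ≠ ∞ ∧ ∀ (f : Euc n → ℝ) (h : Euc n → ℝ≥0∞), Measurable f →
      (∃ N : ℝ, ∀ x, |f x| ≤ N) → OscBound U f h → Measurable h →
      (⨍ y in cube x₀ R₀, f y) = 0 →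
      ∫⁻ x in U, ‖f x‖ₑ ^ q ≤ C * ∫⁻ x in U, h x ^ q := by
  have hne : Uᶜ.Nonempty := by
    rw [nonempty_compl]
    rintro rfl
    have : Nonempty (Fin n) := ⟨⟨0, hn⟩⟩
    exact NormedSpace.unbounded_univ ℝ (Euc n) hb
  have hq0 : 0 < q := by linarith
  have hq1 : 0 < q - 1 := by linarith
  have hqp : q.HolderConjugate (Real.conjExponent q) := Real.HolderConjugate.conjExponent hq
  set p := Real.conjExponent q
  have hp1 : 1 < p := hqp.symm.lt
  have hp0 : 0 < p := by linarith
  have hqp' : (q - 1) * p = q := hqp.sub_one_mul_conj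
  obtain ⟨a, B, C₁, ha, ha1, hB, hC₁, H₁⟩ := hcone.exists_avg_bound hn hU hc hb hx₀ hR₀ hx₀R
  obtain ⟨C₂, hC₂, H₂⟩ := exists_lintegral_le_maxFn hU.measurableSet hb
  obtain ⟨C₃, hC₃, H₃⟩ := exists_lintegral_maxFn_rpow_le hn hq
  obtain ⟨C₄, hC₄, H₄⟩ := exists_lintegral_maxFn_rpow_le hn hp1
  set K₁ : ℝ≥0∞ := 2 * (2 * 2 ^ n + (2 ^ n + 4 ^ n + ENNReal.ofReal (1 / a) ^ n + 1)) with hK₁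
  have hK₁t : K₁ ≠ ∞ := by finiteness
  set K₂ : ℝ≥0∞ := C₁ * (ENNReal.ofReal (4 * B) ^ n + C₂) with hK₂
  have hK₂t : K₂ ≠ ∞ := by finiteness
  set K₃ : ℝ≥0∞ := 2 ^ (p - 1) * (1 + K₂ ^ p * C₄) * ((2 ^ n) ^ q * C₃) with hK₃
  have hK₃t : K₃ ≠ ∞ := by
    have h1 : (2 : ℝ≥0∞) ^ (p - 1) ≠ ∞ := ENNReal.rpow_ne_top_of_nonneg (by linarith) (by simp)
    have h2 : K₂ ^ p ≠ ∞ := ENNReal.rpow_ne_top_of_nonneg hp0.le hK₂t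
    have h3 : ((2 : ℝ≥0∞) ^ n) ^ q ≠ ∞ := ENNReal.rpow_ne_top_of_nonneg hq0.le (by finiteness)
    finiteness
  refine ⟨(2 ^ (q - 1) * K₁ * K₃ ^ (1 / p)) ^ q, ?_, ?_⟩
  · refine ENNReal.rpow_ne_top_of_nonneg hq0.le ?_
    have h1 : (2 : ℝ≥0∞) ^ (q - 1) ≠ ∞ := ENNReal.rpow_ne_top_of_nonneg hq1.le (by simp)
    have h2 : K₃ ^ (1 / p) ≠ ∞ := ENNReal.rpow_ne_top_of_nonneg (by positivity) hK₃t
    finiteness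
  intro f h hfm ⟨N, hN⟩ hfh hhm hf0
  have hfloc : LocallyIntegrable f := by
    intro x
    refine ⟨Metric.ball x 1, Metric.ball_mem_nhds x one_pos, ?_⟩
    exact Measure.integrableOn_of_bounded (M := N) measure_ball_lt_top.ne
      hfm.aestronglyMeasurable (Filter.Eventually.of_forall fun x => hN x)
  have hfU : IntegrableOn f U :=
    (hfloc.integrableOn_isCompact hb.isCompact_closure).mono_set subset_closure
  set X := ∫⁻ x in U, ‖f x‖ₑ ^ q with hX
  have hXtop : X ≠ ∞ := by
    have h1 : X ≤ ∫⁻ _ in U, ENNReal.ofReal N ^ q := by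
      refine lintegral_mono fun x => ?_
      gcongr
      rw [← ofReal_norm]
      exact ENNReal.ofReal_le_ofReal (hN x)
    rw [setLIntegral_const] at h1
    refine ne_top_of_le_ne_top ?_ h1
    have := hb.measure_lt_top (μ := volume)
    have h2 : ENNReal.ofReal N ^ q ≠ ∞ := ENNReal.rpow_ne_top_of_nonneg hq0.le (by simp)
    finiteness
  set A : Euc n → ℝ≥0∞ := fun x => C₁ * (coneOp U B h x + ∫⁻ y in U, h y) with hA
  have hAm : Measurable A := ((measurable_coneOp U B hhm).add measurable_const).const_mul _
  set F : Euc n → ℝ≥0∞ := U.indicator fun y => ‖f y‖ₑ with hF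
  have hFm : Measurable F := hfm.enorm.indicator hU.measurableSet
  have hFq : ∫⁻ x, F x ^ q = X := by
    rw [hX, ← lintegral_indicator hU.measurableSet]
    refine lintegral_congr fun x => ?_
    by_cases hx : x ∈ U <;> simp [hF, hx, hq0]
  set M : Euc n → ℝ≥0∞ := fun x => 2 ^ n * maxFn F x with hM
  have hMm : Measurable M := (measurable_maxFn F).const_mul _
  set G : Euc n → ℝ≥0∞ := fun x => M x ^ (q - 1) with hG
  have hGm : Measurable G := hMm.pow_const _
  have hmain : X ≤ 2 ^ (q - 1) * K₁ * ∫⁻ x in U, (h x + A x) * G x := by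
    refine lintegral_rpow_le_of_superlevel hfm.enorm hMm (hhm.add hAm) hq hK₁t fun t _ => ?_
    rw [Measure.restrict_restrict (measurableSet_lt measurable_const hfm.enorm),
      Measure.restrict_restrict (measurableSet_lt measurable_const hMm), inter_comm,
      inter_comm _ U]
    refine hfh.lintegral_superlevel_le hn hU hb hfm hfloc ha ha1 (A := A) ?_ (by simp)
    intro x hx l hl hxl hxd
    have h1 := H₁ f h hfU hfh hhm x hx l hl hxl hxd
    rwa [hf0, sub_zero] at h1
  -- A pointwise majorant on `U` for the transpose of `h ↦ h + A` applied to `G`. Since `(q - 1) p =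
  -- q`, both summands have `L^p` norm controlled by `X`.
  set W : Euc n → ℝ≥0∞ := fun y => G y + K₂ * maxFn (U.indicator G) y with hW
  have hWm : Measurable W := hGm.add ((measurable_maxFn _).const_mul _)
  have hdual : ∫⁻ x in U, (h x + A x) * G x ≤ ∫⁻ x in U, h x * W x := by
    have m1 : Measurable fun x => h x * G x := hhm.mul hGm
    have m2 : Measurable fun x => C₁ * (coneOp U B h x * G x) :=
      ((measurable_coneOp U B hhm).mul hGm).const_mul _
    have e1 : ∀ x, (h x + A x) * G x =
        h x * G x + (C₁ * (coneOp U B h x * G x) + C₁ * ((∫⁻ y in U, h y) * G x)) := fun x => by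
      simp only [hA]; ring
    have e2 : ∫⁻ x in U, C₁ * ((∫⁻ y in U, h y) * G x) ≤
        C₁ * (C₂ * ∫⁻ y in U, h y * maxFn (U.indicator G) y) := by
      rw [lintegral_const_mul' _ _ hC₁, lintegral_const_mul _ hGm, ← lintegral_mul_const _ hhm,
        ← lintegral_const_mul' _ _ hC₂]
      refine mul_le_mul_right ?_ _
      refine setLIntegral_mono' hU.measurableSet fun y hy => ?_
      rw [mul_left_comm]
      gcongr
      exact H₂ G y hy
    have e3 : ∫⁻ x in U, h x * W x = (∫⁻ x in U, h x * G x) +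
        K₂ * ∫⁻ x in U, h x * maxFn (U.indicator G) x := by
      rw [← lintegral_const_mul' _ _ hK₂t, ← lintegral_add_left m1]
      refine lintegral_congr fun x => ?_
      simp only [hW]; ring
    simp_rw [e1]
    rw [lintegral_add_left m1, lintegral_add_left m2, e3, lintegral_const_mul' _ _ hC₁]
    refine add_le_add le_rfl ?_
    refine (add_le_add (mul_le_mul_right (lintegral_coneOp_mul_le hU hne hB hhm hGm) C₁)
      e2).trans (le_of_eq ?_)
    rw [hK₂]; ring
  have hGp : ∫⁻ x, G x ^ p ≤ (2 ^ n) ^ q * C₃ * X := by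
    have e1 : ∀ x, G x ^ p = (2 ^ n) ^ q * maxFn F x ^ q := fun x => by
      simp only [hG, hM]
      rw [← ENNReal.rpow_mul, hqp', ENNReal.mul_rpow_of_nonneg _ _ hq0.le]
    simp_rw [e1]
    rw [lintegral_const_mul _ ((measurable_maxFn F).pow_const q), mul_assoc]
    gcongr
    exact (H₃ F hFm.aemeasurable).trans_eq (by rw [hFq])
  have hWp : ∫⁻ x in U, W x ^ p ≤ K₃ * X := by
    have e1 : ∫⁻ x, maxFn (U.indicator G) x ^ p ≤ C₄ * ∫⁻ x, G x ^ p := by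
      refine (H₄ _ (hGm.indicator hU.measurableSet).aemeasurable).trans ?_
      gcongr with x
      exact indicator_le_self _ _ x
    calc ∫⁻ x in U, W x ^ p ≤ ∫⁻ x, W x ^ p := setLIntegral_le_lintegral _ _
      _ ≤ ∫⁻ x, 2 ^ (p - 1) * (G x ^ p + K₂ ^ p * maxFn (U.indicator G) x ^ p) := by
          refine lintegral_mono fun x => ?_
          rw [← ENNReal.mul_rpow_of_nonneg _ _ hp0.le]
          exact ENNReal.rpow_add_le_mul_rpow_add_rpow _ _ hp1.le
      _ = 2 ^ (p - 1) * ((∫⁻ x, G x ^ p) + K₂ ^ p * ∫⁻ x, maxFn (U.indicator G) x ^ p) := by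
          have m1 : Measurable fun x => maxFn (U.indicator G) x ^ p :=
            (measurable_maxFn _).pow_const _
          have m2 : Measurable fun x => G x ^ p := hGm.pow_const _
          have m3 : Measurable fun x => G x ^ p + K₂ ^ p * maxFn (U.indicator G) x ^ p :=
            m2.add (m1.const_mul _)
          rw [lintegral_const_mul _ m3, lintegral_add_left m2, lintegral_const_mul _ m1]
      _ ≤ 2 ^ (p - 1) * ((∫⁻ x, G x ^ p) + K₂ ^ p * (C₄ * ∫⁻ x, G x ^ p)) := by gcongr
      _ = 2 ^ (p - 1) * (1 + K₂ ^ p * C₄) * ∫⁻ x, G x ^ p := by ring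
      _ ≤ 2 ^ (p - 1) * (1 + K₂ ^ p * C₄) * ((2 ^ n) ^ q * C₃ * X) := by gcongr
      _ = K₃ * X := by rw [hK₃]; ring
  refine rpow_le_of_le_mul_rpow_mul_rpow hqp hXtop ?_
  calc X ≤ 2 ^ (q - 1) * K₁ * ∫⁻ x in U, h x * W x := hmain.trans (by gcongr)
    _ ≤ 2 ^ (q - 1) * K₁ * ((∫⁻ x in U, h x ^ q) ^ (1 / q) *
        (∫⁻ x in U, W x ^ p) ^ (1 / p)) := by
        gcongr
        exact ENNReal.lintegral_mul_le_Lp_mul_Lq _ hqp hhm.aemeasurable hWm.aemeasurable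
    _ ≤ 2 ^ (q - 1) * K₁ * ((∫⁻ x in U, h x ^ q) ^ (1 / q) * (K₃ * X) ^ (1 / p)) := by gcongr
    _ = _ := by
        rw [ENNReal.mul_rpow_of_nonneg _ _ (by positivity : 0 ≤ 1 / p)]; ring

/-! ### John domains and Lipschitz domains satisfy the twisted cone condition -/

/-- A ball is connected, so it cannot meet both `U` and the complement of its closure without
meeting the frontier. -/
theorem ball_subset_of_disjoint_frontier {n : ℕ} {U : Set (Euc n)} (hU : IsOpen U) {y : Euc n}
    (hy : y ∈ U) {r : ℝ} (h : Disjoint (Metric.ball y r) (frontier U)) :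
    Metric.ball y r ⊆ U := by
  rcases le_or_gt r 0 with hr | hr
  · rw [Metric.ball_eq_empty.2 hr]; exact empty_subset _
  refine (convex_ball y r).isPreconnected.subset_left_of_subset_union hU
    isClosed_closure.isOpen_compl
    (disjoint_compl_right.mono_left subset_closure) (fun z hz => ?_) ⟨y, Metric.mem_ball_self hr, hy⟩
  by_contra hcon
  simp only [mem_union, mem_compl_iff, not_or, not_not] at hcon
  refine disjoint_left.1 h hz ?_
  rw [frontier, hU.interior_eq]
  exact ⟨hcon.2, hcon.1⟩

/-- Arc length parametrization is 1-Lipschitz, since displacement is at most variation; any fixed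
ball about the centre serves as the final ball. -/
theorem IsJohnDomain.twistedConeCondition {n : ℕ} {U : Set (Euc n)} (h : IsJohnDomain U) :
    TwistedConeCondition U := by
  obtain ⟨x₀, hx₀, c, L, hc, H⟩ := h.exists_center
  obtain ⟨r₀, hr₀, hball⟩ := Metric.isOpen_iff.1 h.isOpen x₀ hx₀
  refine ⟨c, r₀, hc, hr₀, fun x hx => ?_⟩
  obtain ⟨s, γ, hs, -, hγ, hγ0, hγs, hdist⟩ := H x hx
  refine ⟨s, γ, hs, hγ0, ?_, fun t ht => ?_, hγs ▸ hball⟩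
  · have key : ∀ t ∈ Icc 0 s, ∀ t' ∈ Icc 0 s, t ≤ t' → dist (γ t) (γ t') ≤ |t - t'| := by
      intro t ht t' ht' hle
      have h1 := hγ ht ht'
      have h2 := eVariationOn.edist_le γ (s := Icc 0 s ∩ Icc t t') ⟨ht, le_rfl, hle⟩ ⟨ht', hle, le_rfl⟩
      rw [h1, edist_dist] at h2
      have h3 : dist (γ t) (γ t') ≤ (1 : ℝ≥0) * (t' - t) :=
        (ENNReal.ofReal_le_ofReal_iff (by simpa using hle)).1 h2
      rw [abs_sub_comm, abs_of_nonneg (sub_nonneg.2 hle)]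
      simpa using h3
    intro t ht t' ht'
    rcases le_total t t' with hle | hle
    · exact key t ht t' ht' hle
    · rw [dist_comm, abs_sub_comm]; exact key t' ht' t ht hle
  · obtain ⟨h1, h2⟩ := hdist t ht
    refine ball_subset_of_disjoint_frontier h.isOpen h1 (disjoint_left.2 fun z hz hzf => ?_)
    have h3 := Metric.infDist_le_dist_of_mem (x := γ t) hzf
    rw [Metric.mem_ball, dist_comm] at hz
    linarith

theorem HasTwistedCone.mono {n : ℕ} {U : Set (Euc n)} {c c' r₀ r₀' : ℝ} {x : Euc n}
    (h : HasTwistedCone U c r₀ x) (hc : c' ≤ c) (hr : r₀' ≤ r₀) : HasTwistedCone U c' r₀' x := by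
  obtain ⟨s, γ, hs, h0, h1, h2, h3⟩ := h
  refine ⟨s, γ, hs, h0, h1, fun t ht => ?_, (Metric.ball_subset_ball hr).trans h3⟩
  exact (Metric.ball_subset_ball (mul_le_mul_of_nonneg_right hc ht.1)).trans (h2 t ht)

/-- Points above the graph of a Lipschitz function are vertices of vertical cones. -/
theorem hasTwistedCone_of_epigraph {n : ℕ} {U : Set (Euc n)} {p : Euc n} {r : ℝ}
    (T : Euc n ≃ₗᵢ[ℝ] WithLp 2 (Euc (n - 1) × ℝ)) {g : Euc (n - 1) → ℝ} {K : ℝ≥0} (hr : 0 < r)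
    (hg : LipschitzWith K g)
    (hU : ∀ y ∈ Metric.ball p r, (y ∈ U ↔ g (T y).fst < (T y).snd)) {x : Euc n} (hx : x ∈ U)
    (hxp : x ∈ Metric.ball p (r / 2)) :
    HasTwistedCone U (1 / (1 + K)) (1 / (1 + K) * (r / 4)) x := by
  -- Within distance `c t` of the point raised by `t`, the height drops by less than `c t` and the
  -- graph rises by at most `K c t`; the two losses add up to at most `t`.
  set c : ℝ := 1 / (1 + K) with hc
  have hc0 : 0 < c := by positivity
  have hK : (0 : ℝ) ≤ K := K.2
  have hcK : c * (1 + K) = 1 := by rw [hc]; field_simp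
  have hc1 : c ≤ 1 := by nlinarith
  set e : Euc n := T.symm (WithLp.toLp 2 (0, 1)) with he
  have hTe : T e = WithLp.toLp 2 (0, 1) := T.apply_symm_apply _
  have hnorm : ‖e‖ = 1 := by
    rw [← T.norm_map e, hTe, WithLp.prod_norm_eq_of_L2]; simp
  rw [Metric.mem_ball] at hxp
  have hxlt : g (T x).fst < (T x).snd := (hU x (by rw [Metric.mem_ball]; linarith)).1 hx
  have key : ∀ t ∈ Icc 0 (r / 4), Metric.ball (x + t • e) (c * t) ⊆ U := by
    intro t ht y hy
    rw [Metric.mem_ball] at hy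
    have hct : c * t ≤ t := by nlinarith [ht.1]
    have hγx : dist (x + t • e) x = t := by
      rw [dist_eq_norm, add_sub_cancel_left, norm_smul, hnorm, mul_one, Real.norm_of_nonneg ht.1]
    have hyp : y ∈ Metric.ball p r := by
      rw [Metric.mem_ball]
      have h1 := dist_triangle4 y (x + t • e) x p
      linarith [ht.2]
    rw [hU y hyp]
    have hTγ : T (x + t • e) = T x + t • WithLp.toLp 2 (0, 1) := by
      rw [map_add, map_smul, hTe]
    have hd : ‖T y - (T x + t • WithLp.toLp 2 (0, 1))‖ < c * t := by
      rw [← hTγ, ← map_sub, T.norm_map, ← dist_eq_norm]; exact hy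
    have h1 : ‖(T y).fst - (T x).fst‖ < c * t := by
      refine lt_of_le_of_lt ?_ hd
      have := WithLp.norm_fst_le (p := 2) _ (T y - (T x + t • WithLp.toLp 2 (0, 1)))
      simpa using this
    have h2 : |(T y).snd - ((T x).snd + t)| < c * t := by
      refine lt_of_le_of_lt ?_ hd
      have := WithLp.norm_snd_le (p := 2) _ (T y - (T x + t • WithLp.toLp 2 (0, 1)))
      simpa using this
    have h3 := hg.dist_le_mul (T y).fst (T x).fst
    rw [Real.dist_eq, dist_eq_norm] at h3
    have h4 := (abs_le.1 h3).2
    have h5 := (abs_lt.1 h2).1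
    have h6 : K * ‖(T y).fst - (T x).fst‖ ≤ K * (c * t) := by gcongr
    nlinarith [congrArg (· * t) hcK]
  refine ⟨r / 4, fun t => x + t • e, by positivity, by simp, ?_, key, key _ ⟨by positivity, le_rfl⟩⟩
  intro t _ t' _
  rw [dist_add_left, dist_eq_norm, ← sub_smul, norm_smul, hnorm, mul_one, Real.norm_eq_abs]

/-- Compactness of the closure makes local constants uniform: vertical cones near boundary points,
degenerate ones near interior points. -/
theorem IsLipschitzDomain.twistedConeCondition {n : ℕ} {U : Set (Euc n)}
    (h : IsLipschitzDomain U) : TwistedConeCondition U := by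
  have hcpt : IsCompact (closure U) := h.isBounded.isCompact_closure
  let P : Set (Euc n) → Prop := fun S => ∃ c r₀ : ℝ, 0 < c ∧ 0 < r₀ ∧ ∀ x ∈ U ∩ S,
    HasTwistedCone U c r₀ x
  have hP : P (closure U) := by
    refine hcpt.induction_on (p := P) ?_ ?_ ?_ ?_
    · exact ⟨1, 1, one_pos, one_pos, by simp⟩
    · rintro S S' hSS' ⟨c, r₀, hc, hr, H⟩
      exact ⟨c, r₀, hc, hr, fun x hx => H x ⟨hx.1, hSS' hx.2⟩⟩
    · rintro S S' ⟨c, r₀, hc, hr, H⟩ ⟨c', r₀', hc', hr', H'⟩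
      refine ⟨min c c', min r₀ r₀', lt_min hc hc', lt_min hr hr', ?_⟩
      rintro x ⟨hxU, hx | hx⟩
      · exact (H x ⟨hxU, hx⟩).mono (min_le_left _ _) (min_le_left _ _)
      · exact (H' x ⟨hxU, hx⟩).mono (min_le_right _ _) (min_le_right _ _)
    · intro p hp
      by_cases hpU : p ∈ U
      · obtain ⟨r, hr, hrU⟩ := Metric.isOpen_iff.1 h.isOpen p hpU
        refine ⟨Metric.ball p (r / 2), mem_nhdsWithin_of_mem_nhds
          (Metric.ball_mem_nhds p (half_pos hr)), 1, r / 2, one_pos, half_pos hr, ?_⟩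
        rintro x ⟨-, hx⟩
        -- A curve of length zero suffices: the only cone ball is empty, and the final ball lies in
        -- `U`.
        refine ⟨0, fun _ => x, le_rfl, rfl, by simp, fun t ht => ?_, ?_⟩
        · have : t = 0 := le_antisymm ht.2 ht.1
          simp [this]
        · refine (Metric.ball_subset_ball' ?_).trans hrU
          rw [Metric.mem_ball] at hx
          linarith
      · have hpf : p ∈ frontier U := by
          rw [frontier, h.isOpen.interior_eq]; exact ⟨hp, hpU⟩
        obtain ⟨r, T, g, K, hr, hg, H⟩ := h.locally_epigraph p hpf
        refine ⟨Metric.ball p (r / 2), mem_nhdsWithin_of_mem_nhds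
          (Metric.ball_mem_nhds p (half_pos hr)), 1 / (1 + K), 1 / (1 + K) * (r / 4),
          by positivity, by positivity, fun x hx => ?_⟩
        exact hasTwistedCone_of_epigraph T hr hg H hx.1 hx.2
  obtain ⟨c, r₀, hc, hr₀, H⟩ := hP
  exact ⟨c, r₀, hc, hr₀, fun x hx => H x ⟨hx, subset_closure hx⟩⟩

/-! ### Truncation and passage to the limit -/

theorem lintegral_sub_setAverage_le {α : Type*} [MeasurableSpace α] {μ : Measure α} {A : Set α}
    (hA : μ A ≠ 0) (hA' : μ A ≠ ∞) {f : α → ℝ} (hf : IntegrableOn f A μ) (c : ℝ) :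
    ∫⁻ x in A, ‖f x - ⨍ y in A, f y ∂μ‖ₑ ∂μ ≤ 2 * ∫⁻ x in A, ‖f x - c‖ₑ ∂μ := by
  have h1 := enorm_setAverage_sub_le subset_rfl hA hA' hf c
  calc ∫⁻ x in A, ‖f x - ⨍ y in A, f y ∂μ‖ₑ ∂μ
      ≤ ∫⁻ x in A, (‖f x - c‖ₑ + ‖c - ⨍ y in A, f y ∂μ‖ₑ) ∂μ :=
        lintegral_mono fun x => enorm_sub_le_add _ _ _
    _ = (∫⁻ x in A, ‖f x - c‖ₑ ∂μ) + ‖(⨍ y in A, f y ∂μ) - c‖ₑ * μ A := by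
        rw [lintegral_add_right _ measurable_const, setLIntegral_const, ← enorm_neg (c - _),
          neg_sub]
    _ ≤ (∫⁻ x in A, ‖f x - c‖ₑ ∂μ) + (∫⁻ x in A, ‖f x - c‖ₑ ∂μ) / μ A * μ A := by gcongr
    _ = _ := by rw [ENNReal.div_mul_cancel hA hA', two_mul]

/-- Truncation of a real number to the interval `[-N, N]`. -/
noncomputable def truncation (N t : ℝ) : ℝ := max (min t N) (-N)

theorem abs_truncation_le {N : ℝ} (hN : 0 ≤ N) (t : ℝ) : |truncation N t| ≤ N := by
  rw [abs_le]
  exact ⟨le_max_right _ _, max_le (min_le_right _ _) (by linarith)⟩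

theorem abs_truncation_sub_le (N s t : ℝ) : |truncation N s - truncation N t| ≤ |s - t| :=
  (abs_max_sub_max_le_abs _ _ _).trans (abs_inf_sub_inf_le_abs _ _ _)

theorem truncation_of_abs_le {N t : ℝ} (h : |t| ≤ N) : truncation N t = t := by
  rw [abs_le] at h
  rw [truncation, min_eq_left h.2, max_eq_left h.1]

theorem abs_truncation_le_abs {N : ℝ} (hN : 0 ≤ N) (t : ℝ) : |truncation N t| ≤ |t| := by
  have h := abs_truncation_sub_le N t 0
  rwa [truncation_of_abs_le (t := 0) (by simpa using hN), sub_zero, sub_zero] at h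

theorem continuous_truncation (N : ℝ) : Continuous (truncation N) := by
  unfold truncation; fun_prop

theorem tendsto_truncation (t : ℝ) :
    Filter.Tendsto (fun N : ℕ => truncation N t) Filter.atTop (nhds t) := by
  refine tendsto_const_nhds.congr' ?_
  filter_upwards [Filter.eventually_ge_atTop ⌈|t|⌉₊] with N hN
  rw [truncation_of_abs_le ((Nat.le_ceil _).trans (by exact_mod_cast hN))]

/-- Truncation is 1-Lipschitz, so the truncated average of `ψ` is a competing constant with no
larger deviation; returning to the true average costs the factor 2. -/
theorem oscBound_truncation {n : ℕ} (hn : 0 < n) {U : Set (Euc n)} {ψ φ : Euc n → ℝ}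
    (hφm : Measurable φ) (hφ : φ =ᵐ[volume.restrict U] ψ) {N : ℝ} (hN : 0 ≤ N) (c : ℝ) :
    OscBound U (fun x => truncation N (φ x) - c) fun x => 2 * sharpMaximal U ψ x := by
  intro z r hz x hx
  have hr : 0 < r := (abs_nonneg _).trans_lt (hx ⟨0, hn⟩)
  have hm : Measurable fun x => truncation N (φ x) - c :=
    ((continuous_truncation N).measurable.comp hφm).sub_const c
  have hint : IntegrableOn (fun x => truncation N (φ x) - c) (cube z r) := by
    refine Measure.integrableOn_of_bounded (M := N + |c|) (volume_cube_ne_top z r)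
      hm.aestronglyMeasurable (Filter.Eventually.of_forall fun x => ?_)
    exact (abs_sub _ _).trans (by gcongr; exact abs_truncation_le hN _)
  refine (lintegral_sub_setAverage_le (volume_cube_ne_zero z hr) (volume_cube_ne_top z r) hint
    (truncation N (⨍ w in cube z r, ψ w) - c)).trans ?_
  rw [mul_assoc]
  gcongr
  refine le_trans ?_ (lintegral_le_sharpMaximal_mul ψ hr hz hx)
  refine lintegral_mono_ae ?_
  filter_upwards [ae_restrict_of_ae_restrict_of_subset hz hφ] with y hy
  rw [sub_sub_sub_cancel_right, hy, enorm_le_iff_norm_le, Real.norm_eq_abs, Real.norm_eq_abs]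
  exact abs_truncation_sub_le _ _ _

/-- Truncations of a measurable representative, recentred to have mean zero on the reference cube,
satisfy the bounded estimate uniformly in `N`; Fatou's lemma passes to the limit. -/
theorem TwistedConeCondition.exists_lintegral_sub_avg_le {n : ℕ} (hn : 0 < n) {U : Set (Euc n)}
    (hU : IsOpen U) (hc : IsPreconnected U) (hb : Bornology.IsBounded U)
    (hcone : TwistedConeCondition U) {x₀ : Euc n} (hx₀ : x₀ ∈ U) {R₀ : ℝ}
    (hR₀ : 0 < R₀) (hx₀R : cube x₀ R₀ ⊆ U) {q : ℝ} (hq : 1 < q) :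
    ∃ C : ℝ≥0∞, C ≠ ∞ ∧ ∀ ψ : Euc n → ℝ, IntegrableOn ψ U →
      ∫⁻ x in U, ‖ψ x - ⨍ y in cube x₀ R₀, ψ y‖ₑ ^ q ≤ C * ∫⁻ x in U, sharpMaximal U ψ x ^ q := by
  obtain ⟨C, hC, H⟩ := hcone.exists_bounded_lintegral_le hn hU hc hb hx₀ hR₀ hx₀R hq
  have hq0 : 0 < q := by linarith
  have h2q : (2 : ℝ≥0∞) ^ q ≠ ∞ := ENNReal.rpow_ne_top_of_nonneg hq0.le (by simp)
  refine ⟨C * 2 ^ q, by finiteness, fun ψ hψ => ?_⟩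
  set φ : Euc n → ℝ := hψ.aestronglyMeasurable.mk ψ with hφ
  have hφm : Measurable φ := hψ.aestronglyMeasurable.stronglyMeasurable_mk.measurable
  have hφψ : φ =ᵐ[volume.restrict U] ψ := hψ.aestronglyMeasurable.ae_eq_mk.symm
  have hφψ' : φ =ᵐ[volume.restrict (cube x₀ R₀)] ψ :=
    ae_restrict_of_ae_restrict_of_subset hx₀R hφψ
  have hφint : IntegrableOn φ (cube x₀ R₀) := (hψ.mono_set hx₀R).congr hφψ'.symm
  have hQ0 := volume_cube_ne_zero x₀ hR₀
  have hQt := volume_cube_ne_top x₀ R₀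
  set m : ℕ → ℝ := fun N => ⨍ y in cube x₀ R₀, truncation N (φ y) with hm
  have hTm : ∀ N : ℕ, Measurable fun x => truncation N (φ x) := fun N =>
    (continuous_truncation N).measurable.comp hφm
  have hTint : ∀ N : ℕ, IntegrableOn (fun x => truncation N (φ x)) (cube x₀ R₀) := fun N => by
    refine Integrable.mono hφint (hTm N).aestronglyMeasurable (Filter.Eventually.of_forall
      fun x => ?_)
    exact abs_truncation_le_abs (Nat.cast_nonneg N) _
  have hmlim : Filter.Tendsto m Filter.atTop (nhds (⨍ y in cube x₀ R₀, ψ y)) := by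
    have h1 : (⨍ y in cube x₀ R₀, ψ y) = ⨍ y in cube x₀ R₀, φ y := average_congr hφψ'.symm
    rw [h1, hm]
    simp only [setAverage_eq]
    refine Filter.Tendsto.const_smul ?_ _
    refine tendsto_integral_of_dominated_convergence (fun x => |φ x|)
      (fun N => (hTm N).aestronglyMeasurable) hφint.abs
      (fun N => Filter.Eventually.of_forall fun x => abs_truncation_le_abs (Nat.cast_nonneg N) _)
      (Filter.Eventually.of_forall fun x => tendsto_truncation _)
  have hbound : ∀ N : ℕ, ∫⁻ x in U, ‖truncation N (φ x) - m N‖ₑ ^ q ≤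
      C * 2 ^ q * ∫⁻ x in U, sharpMaximal U ψ x ^ q := by
    intro N
    refine (H _ _ ((hTm N).sub_const (m N)) ⟨N + |m N|, fun x => ?_⟩
      (oscBound_truncation hn hφm hφψ (Nat.cast_nonneg N) (m N))
      ((measurable_sharpMaximal U ψ).const_mul 2) ?_).trans (le_of_eq ?_)
    · exact (abs_sub _ _).trans (by gcongr; exact abs_truncation_le (Nat.cast_nonneg N) _)
    · have h1 : (⨍ _ in cube x₀ R₀, m N) = m N := setAverage_const hQ0 hQt _
      have h2 : (⨍ y in cube x₀ R₀, (truncation N (φ y) - m N)) = m N - ⨍ _ in cube x₀ R₀, m N := by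
        simp only [hm, setAverage_eq]
        rw [integral_sub (hTint N) (integrableOn_const hQt), smul_sub]
      rw [h2, h1, sub_self]
    · have h1 : ∀ x, (2 * sharpMaximal U ψ x) ^ q = 2 ^ q * sharpMaximal U ψ x ^ q := fun x =>
        ENNReal.mul_rpow_of_nonneg _ _ hq0.le
      simp_rw [h1]
      rw [lintegral_const_mul' _ _ h2q, mul_assoc]
  calc ∫⁻ x in U, ‖ψ x - ⨍ y in cube x₀ R₀, ψ y‖ₑ ^ q
      = ∫⁻ x in U, Filter.liminf (fun N : ℕ => ‖truncation N (φ x) - m N‖ₑ ^ q) Filter.atTop := by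
        refine lintegral_congr_ae ?_
        filter_upwards [hφψ] with x hx
        have h1 : Filter.Tendsto (fun N : ℕ => ‖truncation N (φ x) - m N‖ₑ ^ q) Filter.atTop
            (nhds (‖ψ x - ⨍ y in cube x₀ R₀, ψ y‖ₑ ^ q)) := by
          rw [← hx]
          exact ((tendsto_truncation (φ x)).sub hmlim).enorm.ennrpow_const q
        exact h1.liminf_eq.symm
    _ ≤ Filter.liminf (fun N : ℕ => ∫⁻ x in U, ‖truncation N (φ x) - m N‖ₑ ^ q) Filter.atTop :=
        lintegral_liminf_le fun N => ((hTm N).sub_const (m N)).enorm.pow_const q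
    _ ≤ _ := Filter.liminf_le_of_le (by isBoundedDefault) fun b hb => by
        obtain ⟨N, hN⟩ := hb.exists
        exact hN.trans (hbound N)

/-- A bound for a function by its deviation from a constant and by its average. -/
theorem exists_lintegral_rpow_le_add {n : ℕ} {U : Set (Euc n)} (hU0 : volume U ≠ 0)
    (hUt : volume U ≠ ∞) {q : ℝ} (hq : 1 < q) :
    ∃ C D : ℝ≥0∞, C ≠ ∞ ∧ D ≠ ∞ ∧ ∀ (ψ : Euc n → ℝ) (c : ℝ), IntegrableOn ψ U →
      ∫⁻ x in U, ‖ψ x‖ₑ ^ q ≤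
        C * (∫⁻ x in U, ‖ψ x - c‖ₑ ^ q) + D * ‖⨍ x in U, ψ x‖ₑ ^ q := by
  have hq0 : 0 < q := by linarith
  have hqp : q.HolderConjugate (Real.conjExponent q) := Real.HolderConjugate.conjExponent hq
  set p := Real.conjExponent q
  have hp0 : 0 < p := hqp.symm.pos
  set κ : ℝ≥0∞ := volume U ^ (1 / p) / volume U with hκ
  have hκt : κ ≠ ∞ := ENNReal.div_ne_top
    (ENNReal.rpow_ne_top_of_nonneg (by positivity) hUt) hU0
  have h2 : (2 : ℝ≥0∞) ^ (q - 1) ≠ ∞ := ENNReal.rpow_ne_top_of_nonneg (by linarith) (by simp)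
  have hκq : κ ^ q ≠ ∞ := ENNReal.rpow_ne_top_of_nonneg hq0.le hκt
  refine ⟨2 ^ (q - 1) * (1 + 2 ^ (q - 1) * κ ^ q * volume U), 2 ^ (q - 1) * (2 ^ (q - 1) * volume U),
    by finiteness, by finiteness, fun ψ c hψ => ?_⟩
  set J := ∫⁻ x in U, ‖ψ x - c‖ₑ ^ q with hJ
  set a := ⨍ x in U, ψ x with ha
  have hmeas : AEMeasurable (fun x => ‖ψ x - c‖ₑ) (volume.restrict U) :=
    (hψ.aemeasurable.sub_const c).enorm
  have h1 : ‖a - c‖ₑ ^ q ≤ κ ^ q * J := by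
    have e1 := enorm_setAverage_sub_le subset_rfl hU0 hUt hψ c
    have e2 : ∫⁻ x in U, ‖ψ x - c‖ₑ ≤ J ^ (1 / q) * volume U ^ (1 / p) := by
      have := ENNReal.lintegral_mul_le_Lp_mul_Lq (volume.restrict U) hqp hmeas
        (g := fun _ => 1) aemeasurable_const
      simpa using this
    have e3 : ‖a - c‖ₑ ≤ κ * J ^ (1 / q) := by
      refine e1.trans ?_
      rw [hκ, mul_comm, ← mul_div_assoc]
      gcongr
    calc ‖a - c‖ₑ ^ q ≤ (κ * J ^ (1 / q)) ^ q := by gcongr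
      _ = κ ^ q * J := by
        rw [ENNReal.mul_rpow_of_nonneg _ _ hq0.le, ← ENNReal.rpow_mul]; simp [hq0.ne']
  have h3 : ‖c‖ₑ ^ q ≤ 2 ^ (q - 1) * (κ ^ q * J + ‖a‖ₑ ^ q) := by
    calc ‖c‖ₑ ^ q ≤ (‖a - c‖ₑ + ‖a‖ₑ) ^ q := by
          gcongr
          rw [add_comm]
          refine le_add_of_enorm_sub_le (le_of_eq ?_) le_rfl
          rw [← enorm_neg, neg_sub]
      _ ≤ 2 ^ (q - 1) * (‖a - c‖ₑ ^ q + ‖a‖ₑ ^ q) :=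
          ENNReal.rpow_add_le_mul_rpow_add_rpow _ _ hq.le
      _ ≤ _ := by gcongr
  calc ∫⁻ x in U, ‖ψ x‖ₑ ^ q ≤ ∫⁻ x in U, 2 ^ (q - 1) * (‖ψ x - c‖ₑ ^ q + ‖c‖ₑ ^ q) := by
        refine lintegral_mono fun x => ?_
        refine le_trans ?_ (ENNReal.rpow_add_le_mul_rpow_add_rpow _ _ hq.le)
        gcongr
        rw [add_comm]
        exact le_add_of_enorm_sub_le le_rfl le_rfl
    _ = 2 ^ (q - 1) * (J + ‖c‖ₑ ^ q * volume U) := by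
        rw [lintegral_const_mul' _ _ h2, lintegral_add_right _ measurable_const,
          setLIntegral_const]
    _ ≤ 2 ^ (q - 1) * (J + 2 ^ (q - 1) * (κ ^ q * J + ‖a‖ₑ ^ q) * volume U) := by gcongr
    _ = _ := by ring

theorem mainTheorem9 (n : ℕ) (hn : 2 ≤ n) (q : ℝ) (hq : 1 < q)
    (U : Set (EuclideanSpace ℝ (Fin n))) (hU : IsLipschitzDomain U ∨ IsJohnDomain U) :
    ∃ S : ℝ, 0 < S ∧ ∀ ψ : EuclideanSpace ℝ (Fin n) → ℝ,
      IntegrableOn ψ U volume →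
      MemLp (sharpMaximal U ψ) (ENNReal.ofReal q) (volume.restrict U) →
        MemLp (hlMaximal U ψ) (ENNReal.ofReal q) (volume.restrict U) ∧
        (⨍⁻ x in U, hlMaximal U ψ x ^ q ∂volume) ≤
          ENNReal.ofReal S *
            ((⨍⁻ x in U, sharpMaximal U ψ x ^ q ∂volume) + ‖⨍ x in U, ψ x‖ₑ ^ q) := by
  have hn0 : 0 < n := by omega
  have hq0 : 0 < q := by linarith
  have hcone : TwistedConeCondition U :=
    hU.elim (fun h => h.twistedConeCondition) (fun h => h.twistedConeCondition)
  have hdom : IsBoundedDomain U :=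
    hU.elim (fun h => h.toIsBoundedDomain) (fun h => h.toIsBoundedDomain)
  obtain ⟨hUo, hUc, hUb⟩ := hdom
  obtain ⟨x₀, hx₀⟩ := hUc.nonempty
  obtain ⟨R₀, hR₀, hx₀R⟩ := exists_cube_subset hn0 hUo hx₀
  have hU0 : volume U ≠ 0 := (hUo.measure_pos volume ⟨x₀, hx₀⟩).ne'
  have hUt : volume U ≠ ∞ := hUb.measure_lt_top.ne
  obtain ⟨C₁, hC₁, H₁⟩ := hcone.exists_lintegral_sub_avg_le hn0 hUo hUc.isPreconnected hUb hx₀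
    hR₀ hx₀R hq
  obtain ⟨C₂, D₂, hC₂, hD₂, H₂⟩ := exists_lintegral_rpow_le_add hU0 hUt hq
  obtain ⟨C₃, hC₃, H₃⟩ := exists_lintegral_maxFn_rpow_le hn0 hq
  set K : ℝ≥0∞ := C₃ * (C₂ * C₁) with hK
  set L : ℝ≥0∞ := C₃ * D₂ with hL
  have hKt : K ≠ ∞ := by finiteness
  have hLt : L / volume U ≠ ∞ := ENNReal.div_ne_top (by finiteness) hU0
  have hbound : ∀ ψ : Euc n → ℝ, IntegrableOn ψ U → ∫⁻ x in U, hlMaximal U ψ x ^ q ≤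
      K * (∫⁻ x in U, sharpMaximal U ψ x ^ q) + L * ‖⨍ x in U, ψ x‖ₑ ^ q := by
    intro ψ hψ
    have hm : AEMeasurable (U.indicator fun y => ‖ψ y‖ₑ) :=
      (aemeasurable_indicator_iff hUo.measurableSet).2 hψ.aemeasurable.enorm
    calc ∫⁻ x in U, hlMaximal U ψ x ^ q
        ≤ ∫⁻ x, maxFn (U.indicator fun y => ‖ψ y‖ₑ) x ^ q := by
          refine (setLIntegral_le_lintegral _ _).trans (lintegral_mono fun x => ?_)
          gcongr
          exact hlMaximal_le_maxFn ψ x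
      _ ≤ C₃ * ∫⁻ x, (U.indicator fun y => ‖ψ y‖ₑ) x ^ q := H₃ _ hm
      _ = C₃ * ∫⁻ x in U, ‖ψ x‖ₑ ^ q := by
          rw [← lintegral_indicator hUo.measurableSet]
          congr 1
          refine lintegral_congr fun x => ?_
          by_cases hx : x ∈ U <;> simp [hx, hq0]
      _ ≤ C₃ * (C₂ * (C₁ * ∫⁻ x in U, sharpMaximal U ψ x ^ q) + D₂ * ‖⨍ x in U, ψ x‖ₑ ^ q) := by
          gcongr
          refine (H₂ ψ (⨍ y in cube x₀ R₀, ψ y) hψ).trans ?_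
          gcongr
          exact H₁ ψ hψ
      _ = _ := by rw [hK, hL]; ring
  have hqE : ENNReal.ofReal q ≠ 0 := by simpa using hq0
  have hqR : (ENNReal.ofReal q).toReal = q := ENNReal.toReal_ofReal hq0.le
  -- Averaging divides by the volume, but the mean of `ψ` is already normalized, hence `L / volume
  -- U`; the added `1` keeps the constant positive.
  refine ⟨(K + L / volume U).toReal + 1, by positivity, fun ψ hψ hsharp => ⟨?_, ?_⟩⟩
  · refine ⟨(measurable_hlMaximal U ψ).stronglyMeasurable.aestronglyMeasurable, ?_⟩
    have h1 := hsharp.2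
    rw [eLpNorm_lt_top_iff_lintegral_rpow_enorm_lt_top hqE ENNReal.ofReal_ne_top, hqR] at h1 ⊢
    simp only [enorm_eq_self] at h1 ⊢
    refine (hbound ψ hψ).trans_lt ?_
    have h2 : ‖⨍ x in U, ψ x‖ₑ ^ q ≠ ∞ := ENNReal.rpow_ne_top_of_nonneg hq0.le enorm_ne_top
    exact ENNReal.add_lt_top.2 ⟨ENNReal.mul_lt_top hKt.lt_top h1,
      ENNReal.mul_lt_top (by finiteness) h2.lt_top⟩
  · have hS : K + L / volume U ≤ ENNReal.ofReal ((K + L / volume U).toReal + 1) := by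
      rw [ENNReal.ofReal_add ENNReal.toReal_nonneg zero_le_one, ENNReal.ofReal_toReal
        (by finiteness)]
      exact le_self_add
    rw [setLAverage_eq, setLAverage_eq]
    calc (∫⁻ x in U, hlMaximal U ψ x ^ q) / volume U
        ≤ (K * (∫⁻ x in U, sharpMaximal U ψ x ^ q) + L * ‖⨍ x in U, ψ x‖ₑ ^ q) / volume U := by
          gcongr
          exact hbound ψ hψ
      _ = K * ((∫⁻ x in U, sharpMaximal U ψ x ^ q) / volume U) +
          L / volume U * ‖⨍ x in U, ψ x‖ₑ ^ q := by
          simp only [div_eq_mul_inv]; ring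
      _ ≤ (K + L / volume U) * ((∫⁻ x in U, sharpMaximal U ψ x ^ q) / volume U) +
          (K + L / volume U) * ‖⨍ x in U, ψ x‖ₑ ^ q :=
          add_le_add (mul_le_mul_left le_self_add _) (mul_le_mul_left le_add_self _)
      _ = (K + L / volume U) * ((∫⁻ x in U, sharpMaximal U ψ x ^ q) / volume U +
          ‖⨍ x in U, ψ x‖ₑ ^ q) := by ring
      _ ≤ _ := by gcongr
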